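/- Let $\mathbb{T}=\mathbb{R}/\mathbb{Z}$, let $T>0$, let $\omega\subset\mathbb{T}$ be a non-empty open set, and let $\chi_\omega\in C^\infty(\mathbb{T};\mathbb{R})$ satisfy $\chi_\omega(x)>C$ for all $x\in\omega$, for some constant $C>0$. For $s\ge 0$ let $H^s(\mathbb{T})$ be the space of $u\in L^2(\mathbb{T})$ (complex valued) with $\|u\|_{H^s}^2=\sum_{n\in\mathbb{Z}}(1+n^2)^s|\widehat u(n)|^2<\infty$. For $\Phi_0\in L^2(\mathbb{T})$ let $\Phi$ and $\Psi$ in $C([0,T],L^2(\mathbb{T}))$ be the weak solutions of $$ i\partial_t\Phi+\partial_x^2\Phi=0,\quad \Phi(0)=\Phi_0,\qquad\qquad i\partial_t\Psi+\partial_x^2\Psi=\chi_\omega^2\Phi,\quad \Psi(T)=0, $$ so that $\Phi(t)=e^{it\partial_x^2}\Phi_0$. Let $$ S\Phi_0=\int_0^T e^{-it\partial_x^2}\,\chi_\omega^2\,e^{it\partial_x^2}\Phi_0\,dt $$ be the HUM operator. Then: 1. $\Psi$ exists and $S\Phi_0=-i\Psi(0)$ for every $\Phi_0\in L^2(\mathbb{T})$.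 2. For every $s\ge 0$, $S$ is an isomorphism of $H^s(\mathbb{T})$, i.e. it restricts to a linear bijection of $H^s(\mathbb{T})$ onto itself which is continuous with continuous inverse. 3. Consequently, the HUM control is as smooth as the data: for every $s\ge0$ there is a constant $K$ such that for all $u_0\in H^s(\mathbb{T})$ and $\Phi_0\in L^2(\mathbb{T})$ with $S\Phi_0=-iu_0$, the function $g(t)=\chi_\omega e^{it\partial_x^2}\Phi_0$ is continuous with values in $H^s(\mathbb{T})$, satisfies $\|g(t)\|_{H^s}\le K\|u_0\|_{H^s}$ for all $t$, and the problem $i\partial_tu+\partial_x^2u=\chi_\omega g$, $u(0)=u_0$, has a weak solution $u\in C([0,T],L^2(\mathbb{T}))$, each such solution satisfying $u(T)=0$. -/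

import Mathlib

open MeasureTheory

noncomputable section

namespace HUM

/-- The one-dimensional torus `ℝ / ℤ`. -/
abbrev Torus : Type := UnitAddCircle

/-- The normalized Lebesgue (Haar) measure of the torus. -/
abbrev torusMeasure : Measure Torus := AddCircle.haarAddCircle

/-- The space `L²(ℝ/ℤ)` of complex-valued functions. -/
abbrev L2 : Type := Lp ℂ 2 torusMeasure

/-! ### Sobolev spaces on the torus -/

/-- The weight `(1 + n²)^{s/2}`. -/
def sobolevWeight (s : ℝ) (n : ℤ) : ℝ := (1 + (n : ℝ) ^ 2) ^ (s / 2)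

/-- The sequence `(1 + n²)^{s/2} û(n)`, where `û(n)` is the `n`-th Fourier coefficient of `u`. -/
def sobolevCoeff (s : ℝ) (u : L2) (n : ℤ) : ℂ :=
  (sobolevWeight s n : ℂ) * fourierCoeff (u : Torus → ℂ) n

theorem fourierCoeff_add (u v : L2) (n : ℤ) :
    fourierCoeff ((u + v : L2) : Torus → ℂ) n =
      fourierCoeff (u : Torus → ℂ) n + fourierCoeff (v : Torus → ℂ) n := by
  simp only [← fourierBasis_repr, map_add, lp.coeFn_add, Pi.add_apply]

theorem fourierCoeff_smul (c : ℂ) (u : L2) (n : ℤ) :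
    fourierCoeff ((c • u : L2) : Torus → ℂ) n = c * fourierCoeff (u : Torus → ℂ) n := by
  simp only [← fourierBasis_repr, map_smul, lp.coeFn_smul, Pi.smul_apply, smul_eq_mul]

theorem sobolevCoeff_add (s : ℝ) (u v : L2) :
    sobolevCoeff s (u + v) = sobolevCoeff s u + sobolevCoeff s v := by
  funext n
  simp only [sobolevCoeff, fourierCoeff_add, Pi.add_apply, mul_add]

theorem sobolevCoeff_smul (s : ℝ) (c : ℂ) (u : L2) :
    sobolevCoeff s (c • u) = c • sobolevCoeff s u := by
  funext n
  simp only [sobolevCoeff, fourierCoeff_smul, Pi.smul_apply, smul_eq_mul]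
  ring

theorem sobolevWeight_pos (s : ℝ) (n : ℤ) : 0 < sobolevWeight s n :=
  Real.rpow_pos_of_pos (by positivity) _

/-- The subspace of those `u ∈ L²` for which `(1 + n²)^{s/2} û(n)` is square summable. -/
def sobolevSubmodule (s : ℝ) : Submodule ℂ L2 where
  carrier := {u | Memℓp (sobolevCoeff s u) 2}
  add_mem' {u v} hu hv := by
    simp only [Set.mem_ofPred_eq] at hu hv ⊢
    rw [sobolevCoeff_add]
    exact hu.add hv
  zero_mem' := by
    have h : sobolevCoeff s 0 = 0 := by
      have := sobolevCoeff_smul s 0 0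
      simpa using this
    simp only [Set.mem_ofPred_eq]
    rw [h]
    exact zero_memℓp
  smul_mem' c u hu := by
    simp only [Set.mem_ofPred_eq] at hu ⊢
    rw [sobolevCoeff_smul]
    exact hu.const_smul c

/-- The Sobolev space `H^s(ℝ/ℤ)`, `s ≥ 0`, with its own topology: it carries the norm
`‖u‖² = ∑ₙ (1 + n²)^s |û(n)|²` (see `HUM.Sobolev.norm_sq`), not the one of `L²`. -/
def Sobolev (s : ℝ) : Type := sobolevSubmodule s

namespace Sobolev

variable {s : ℝ}

instance : AddCommGroup (Sobolev s) := inferInstanceAs (AddCommGroup (sobolevSubmodule s))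

instance : Module ℂ (Sobolev s) := inferInstanceAs (Module ℂ (sobolevSubmodule s))

/-- The inclusion `H^s ⊆ L²`. -/
def toL2 : Sobolev s →ₗ[ℂ] L2 := (sobolevSubmodule s).subtype

/-- The linear map `u ↦ ((1 + n²)^{s/2} û(n))ₙ` from `H^s` to `ℓ²(ℤ)`. -/
def coeffs : Sobolev s →ₗ[ℂ] lp (fun _ : ℤ => ℂ) 2 where
  toFun u := ⟨sobolevCoeff s (toL2 u), u.2⟩
  map_add' u v := by
    apply Subtype.ext
    exact (congrArg (sobolevCoeff s) (map_add toL2 u v)).trans (sobolevCoeff_add s _ _)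
  map_smul' c u := by
    apply Subtype.ext
    exact (congrArg (sobolevCoeff s) (map_smul toL2 c u)).trans (sobolevCoeff_smul s c _)

theorem coeffs_apply (u : Sobolev s) (n : ℤ) :
    coeffs u n = (sobolevWeight s n : ℂ) * fourierCoeff (toL2 u : Torus → ℂ) n := rfl

theorem coeffs_injective : Function.Injective (coeffs : Sobolev s → _) := by
  intro u v h
  apply Subtype.ext
  apply (fourierBasis (T := (1 : ℝ))).repr.injective
  apply Subtype.ext
  funext n
  have h1 : coeffs u n = coeffs v n := by rw [h]
  rw [coeffs_apply, coeffs_apply] at h1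
  have h2 : (sobolevWeight s n : ℂ) ≠ 0 :=
    Complex.ofReal_ne_zero.mpr (sobolevWeight_pos s n).ne'
  have h3 := mul_left_cancel₀ h2 h1
  rw [← fourierBasis_repr, ← fourierBasis_repr] at h3
  exact h3

instance : NormedAddCommGroup (Sobolev s) :=
  NormedAddCommGroup.induced _ _ (coeffs (s := s)) coeffs_injective

instance : NormedSpace ℂ (Sobolev s) := NormedSpace.induced ℂ _ _ (coeffs (s := s))

theorem norm_sq (u : Sobolev s) :
    ‖u‖ ^ 2 = ∑' n : ℤ, (1 + (n : ℝ) ^ 2) ^ s * ‖fourierCoeff (toL2 u : Torus → ℂ) n‖ ^ 2 := by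
  have h : ‖u‖ = ‖coeffs u‖ := rfl
  have h2 := lp.norm_rpow_eq_tsum (p := 2) (by norm_num) (coeffs u)
  simp only [ENNReal.toReal_ofNat, Real.rpow_two] at h2
  rw [h, h2]
  refine tsum_congr fun n => ?_
  rw [coeffs_apply, norm_mul, mul_pow, Complex.norm_real, Real.norm_eq_abs, sq_abs,
    sobolevWeight, ← Real.rpow_natCast, ← Real.rpow_mul (by positivity)]
  norm_num

end Sobolev

/-! ### The free Schrödinger group and multiplication operators -/

theorem memℓp_flow (t : ℝ) (a : lp (fun _ : ℤ => ℂ) 2) :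
    Memℓp (fun n : ℤ =>
      Complex.exp (-(4 * Real.pi ^ 2 * (n : ℝ) ^ 2 * t : ℝ) * Complex.I) * a n) 2 := by
  have h : Summable fun n : ℤ => ‖a n‖ ^ (2 : ENNReal).toReal :=
    (lp.memℓp a).summable (by norm_num)
  refine memℓp_gen (h.congr fun n => ?_)
  rw [norm_mul, ← Complex.ofReal_neg, Complex.norm_exp_ofReal_mul_I, one_mul]

/-- The operator `e^{it∂ₓ²}` of `L²(ℝ/ℤ)`: since `∂ₓ² e^{2πinx} = -4π²n² e^{2πinx}`, it multiplies
the `n`-th Fourier coefficient by `e^{-4π²in²t}`. -/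
def schrodingerFlow (t : ℝ) (u : L2) : L2 :=
  (fourierBasis (T := (1 : ℝ))).repr.symm
    ⟨fun n : ℤ => Complex.exp (-(4 * Real.pi ^ 2 * (n : ℝ) ^ 2 * t : ℝ) * Complex.I) *
        (fourierBasis (T := (1 : ℝ))).repr u n, memℓp_flow t _⟩

theorem fourierCoeff_schrodingerFlow (t : ℝ) (u : L2) (n : ℤ) :
    fourierCoeff (schrodingerFlow t u : Torus → ℂ) n =
      Complex.exp (-(4 * Real.pi ^ 2 * (n : ℝ) ^ 2 * t : ℝ) * Complex.I) *
        fourierCoeff (u : Torus → ℂ) n := by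
  rw [← fourierBasis_repr, ← fourierBasis_repr, schrodingerFlow,
    LinearIsometryEquiv.apply_symm_apply]

theorem memLp_mul (χ : C(Torus, ℝ)) (u : L2) :
    MemLp (fun x => (χ x : ℂ) * u x) 2 torusMeasure := by
  obtain ⟨K, hK⟩ := isCompact_univ.exists_bound_of_continuousOn (f := χ) χ.continuous.continuousOn
  refine (Lp.memLp u).of_le_mul (c := K) ?_ (Filter.Eventually.of_forall fun x => ?_)
  · exact (Complex.continuous_ofReal.comp χ.continuous).aestronglyMeasurable.mul
      (Lp.memLp u).aestronglyMeasurable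
  · rw [norm_mul, Complex.norm_real]
    exact mul_le_mul_of_nonneg_right (hK x (Set.mem_univ x)) (norm_nonneg _)

/-- Multiplication of `u ∈ L²` by the real continuous function `χ`. -/
def mulOp (χ : C(Torus, ℝ)) (u : L2) : L2 := (memLp_mul χ u).toLp _

/-- The HUM operator `S Φ₀ = ∫₀ᵀ e^{-it∂ₓ²} χ² e^{it∂ₓ²} Φ₀ dt` (an `L²`-valued integral). -/
def humOperator (T : ℝ) (χ : C(Torus, ℝ)) (Φ₀ : L2) : L2 :=
  ∫ t in (0 : ℝ)..T, schrodingerFlow (-t) (mulOp (χ ^ 2) (schrodingerFlow t Φ₀))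

/-! ### Weak solutions of the Schrödinger equation -/

/-- The second derivative of a function on the torus. -/
def secondDeriv (φ : Torus → ℂ) (x : Torus) : ℂ :=
  iteratedDeriv 2 (fun h : ℝ => φ (x + (h : Torus))) 0

/-- `u ∈ C([0,T], L²)` is a weak solution of `i ∂ₜ u + ∂ₓ² u = f` on `[0,T]`: for each smooth test
function `φ` on the torus, `i d/dt ∫ u(t) φ + ∫ u(t) φ'' = ∫ f(t) φ` on `[0,T]`
(with one-sided derivatives at the end points). -/
def IsSchrodingerSolution (T : ℝ) (f u : ℝ → L2) : Prop :=
  ContinuousOn u (Set.Icc 0 T) ∧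
    ∀ φ : Torus → ℂ, ContDiff ℝ (⊤ : ℕ∞) (fun x : ℝ => φ (x : Torus)) →
      ∀ t ∈ Set.Icc (0 : ℝ) T, ∃ d : ℂ,
        HasDerivWithinAt (fun τ : ℝ => ∫ x, u τ x * φ x ∂torusMeasure) d (Set.Icc 0 T) t ∧
        Complex.I * d + ∫ x, u t x * secondDeriv φ x ∂torusMeasure =
          ∫ x, f t x * φ x ∂torusMeasure

/-- `i ∂ₜ Φ + ∂ₓ² Φ = 0`, `Φ(0) = Φ₀`, and `i ∂ₜ Ψ + ∂ₓ² Ψ = χ² Φ`, `Ψ(T) = 0` on `[0,T]`. -/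
def IsHUMPair (T : ℝ) (χ : C(Torus, ℝ)) (Φ₀ : L2) (Φ Ψ : ℝ → L2) : Prop :=
  IsSchrodingerSolution T (fun _ => 0) Φ ∧ Φ 0 = Φ₀ ∧
    IsSchrodingerSolution T (fun t => mulOp (χ ^ 2) (Φ t)) Ψ ∧ Ψ T = 0

end HUM

end

/-! In the Fourier basis, `S` has the matrix `c(m-n) ∫₀ᵀ e^{4π²i(m²-n²)t} dt`, where `c` denotes the
Fourier coefficients of `χ²`. The diagonal is the constant `T c(0)`, and `c(0)`, the mean of `χ²`,
is positive. Off the diagonal the time integral is `O(1/|m²-n²|)` unless `m = -n`. In that resonant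
case `|m-n| = 2|m|`, so the rapid decay of `c` takes over. Hence `S = T c(0) + R`, where `R` gains
one derivative (`sobolevWeight_one_mul_norm_humMatrix_le`, `exists_sobolev_humRemainder`).

Two consequences follow. `R` is compact on `L²`, so `S` is bijective there as soon as it is
injective. Moreover, writing `u = (T c(0))⁻¹ (S u - R u)` and iterating shows that `u` is as smooth
as `S u` (`mem_sobolevSubmodule_of_humCLM`).

Injectivity is a unique continuation argument. Since `⟨u, S u⟩ = ∫₀ᵀ ‖χ e^{it∂ₓ²}u‖² dt`, the kernel
consists of the data whose free evolution is annihilated by `χ` throughout `[0,T]`. By compactness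
of `R` it is finite dimensional, by regularity it lies in `H²`, and differentiation in time shows
that it is stable under `∂ₓ²`. If non-zero, it would contain an eigenfunction of `∂ₓ²`, that is a
combination of `e^{±2πikx}`, vanishing on `ω`, which is impossible
(`fourierCoeff_eq_zero_of_eigenfunction`). Regularity then restricts the bijection of `L²` to `H^s`,
and the open mapping theorem makes the inverse continuous.

The statements on the equations reduce to Duhamel's formula, which produces a weak solution and
gives every weak solution (`isSchrodingerSolution_duhamel`, `IsSchrodingerSolution.eq_duhamel`). At
time `T` its integral term is exactly `S Φ₀`. -/

noncomputable section

namespace HUM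

/-! ### Operators on `ℓ²(ℤ)` -/

/-- The space `ℓ²(ℤ)`. -/
abbrev Seq : Type := lp (fun _ : ℤ => ℂ) 2

theorem norm_sq_eq_tsum (a : Seq) : ‖a‖ ^ 2 = ∑' n, ‖a n‖ ^ 2 := by
  have h := lp.norm_rpow_eq_tsum (p := 2) (by norm_num) a
  simpa only [ENNReal.toReal_ofNat, Real.rpow_two] using h

theorem summable_norm_sq (a : Seq) : Summable fun n => ‖a n‖ ^ 2 := by
  have h := (lp.memℓp a).summable (p := 2) (by norm_num)
  simpa only [ENNReal.toReal_ofNat, Real.rpow_two] using h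

theorem memℓp_two_of_summable {f : ℤ → ℂ} (h : Summable fun n => ‖f n‖ ^ 2) : Memℓp f 2 :=
  memℓp_gen (by simpa only [ENNReal.toReal_ofNat, Real.rpow_two] using h)

theorem summable_norm_sq_weightedShift {d : ℤ → ℂ} {c : ℝ} (hd : ∀ n, ‖d n‖ ≤ c) (σ : ℤ ≃ ℤ)
    (a : Seq) : Summable fun n => ‖d n * a (σ n)‖ ^ 2 := by
  have h : Summable fun n => c ^ 2 * ‖a (σ n)‖ ^ 2 :=
    (σ.summable_iff.mpr (summable_norm_sq a)).mul_left _
  refine h.of_nonneg_of_le (fun _ => by positivity) fun n => ?_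
  rw [norm_mul, mul_pow]
  gcongr
  exact hd n

/-- The operator `(aₙ) ↦ (dₙ a_{σ n})` of `ℓ²(ℤ)`, for a bounded sequence `d`. -/
def weightedShift (d : ℤ → ℂ) (c : ℝ) (hd : ∀ n, ‖d n‖ ≤ c) (σ : ℤ ≃ ℤ) : Seq →L[ℂ] Seq :=
  LinearMap.mkContinuous
    { toFun := fun a => ⟨fun n => d n * a (σ n),
        memℓp_two_of_summable (summable_norm_sq_weightedShift hd σ a)⟩
      map_add' := fun a b => by
        ext n
        simp only [lp.coeFn_add, Pi.add_apply, mul_add]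
      map_smul' := fun r a => by
        ext n
        simp only [lp.coeFn_smul, Pi.smul_apply, smul_eq_mul, RingHom.id_apply]
        ring } c fun a => by
    have hc : 0 ≤ c := (norm_nonneg _).trans (hd 0)
    refine le_of_sq_le_sq ?_ (by positivity)
    rw [norm_sq_eq_tsum, mul_pow, norm_sq_eq_tsum a, ← σ.tsum_eq (fun n => ‖a n‖ ^ 2),
      ← tsum_mul_left]
    refine (summable_norm_sq_weightedShift hd σ a).tsum_le_tsum (fun n => ?_)
      ((σ.summable_iff.mpr (summable_norm_sq a)).mul_left _)
    change ‖d n * a (σ n)‖ ^ 2 ≤ _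
    rw [norm_mul, mul_pow]
    gcongr
    exact hd n

@[simp]
theorem weightedShift_apply (d : ℤ → ℂ) (c : ℝ) (hd : ∀ n, ‖d n‖ ≤ c) (σ : ℤ ≃ ℤ) (a : Seq)
    (n : ℤ) : weightedShift d c hd σ a n = d n * a (σ n) := rfl

theorem norm_weightedShift_le (d : ℤ → ℂ) (c : ℝ) (hd : ∀ n, ‖d n‖ ≤ c) (σ : ℤ ≃ ℤ) :
    ‖weightedShift d c hd σ‖ ≤ c :=
  LinearMap.mkContinuous_norm_le _ ((norm_nonneg _).trans (hd 0)) _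

/-- A matrix dominated by a summable convolution kernel acts on `ℓ²(ℤ)`. -/
theorem exists_clm_of_matrix {M : ℤ → ℤ → ℂ} {k : ℤ → ℝ} (hk : Summable k)
    (hM : ∀ m n, ‖M m n‖ ≤ k (m - n)) :
    ∃ A : Seq →L[ℂ] Seq, ∀ a m, HasSum (fun n => M m n * a n) (A a m) := by
  -- The matrix is cut into its diagonals `m - n = j`. Each is a weighted shift of norm at most `k
  -- j`, so their sum converges absolutely in operator norm.
  let D : ℤ → Seq →L[ℂ] Seq := fun j =>
    weightedShift (fun m => M m (m - j)) (k j) (fun m => by simpa using hM m (m - j))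
      (Equiv.subRight j)
  have hD : Summable D := Summable.of_norm_bounded hk fun j => norm_weightedShift_le _ _ _ _
  refine ⟨∑' j, D j, fun a m => ?_⟩
  have h1 : HasSum (fun j => D j a m) ((∑' j, D j) a m) :=
    (hD.hasSum.mapL (ContinuousLinearMap.apply ℂ Seq a)).mapL
      (lp.evalCLM ℂ (fun _ : ℤ => ℂ) 2 m)
  rw [← (Equiv.subLeft m).hasSum_iff]
  convert h1 using 2 with j
  simp [D]

/-- A diagonal operator whose entries tend to zero is compact. -/
theorem isCompactOperator_weightedShift_refl {d : ℤ → ℂ} {c : ℝ} (hd : ∀ n, ‖d n‖ ≤ c)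
    (h0 : Filter.Tendsto d Filter.cofinite (nhds 0)) :
    IsCompactOperator (weightedShift d c hd (Equiv.refl ℤ)) := by
  have hc : 0 ≤ c := (norm_nonneg _).trans (hd 0)
  -- Truncations to finitely many entries have finite rank, and they converge in operator norm
  -- because `d` tends to zero.
  let e : Finset ℤ → ℤ → ℂ := fun F n => if n ∈ F then d n else 0
  have he : ∀ F n, ‖e F n‖ ≤ c := fun F n => by
    by_cases h : n ∈ F <;> simp [e, h, hc, hd]
  have hfin : ∀ F, IsCompactOperator (weightedShift (e F) c (he F) (Equiv.refl ℤ)) := by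
    intro F
    have hsum : weightedShift (e F) c (he F) (Equiv.refl ℤ) =
        ∑ i ∈ F, (d i • (lp.singleContinuousLinearMap ℂ (fun _ : ℤ => ℂ) 2 i)).comp
          (lp.evalCLM ℂ (fun _ : ℤ => ℂ) 2 i) := by
      ext a n
      rw [sum_apply, lp.coeFn_sum, Finset.sum_apply]
      have heval : ∀ i, lp.evalCLM ℂ (fun _ : ℤ => ℂ) 2 i a = a i := fun _ => rfl
      simp [e, Pi.single_apply, heval]
    rw [hsum]
    have hkey : (∑ i ∈ F, (d i • (lp.singleContinuousLinearMap ℂ (fun _ : ℤ => ℂ) 2 i)).comp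
          (lp.evalCLM ℂ (fun _ : ℤ => ℂ) 2 i)) ∈
        compactOperator (RingHom.id ℂ) Seq Seq := by
      refine Submodule.sum_mem _ fun i _ => ?_
      have hid : IsCompactOperator (id : ℂ → ℂ) :=
        isCompactOperator_id_iff_locallyCompactSpace.mpr inferInstance
      exact (hid.clm_comp (d i • lp.singleContinuousLinearMap ℂ (fun _ : ℤ => ℂ) 2 i)).comp_clm
        (lp.evalCLM ℂ (fun _ : ℤ => ℂ) 2 i)
    exact hkey
  refine isCompactOperator_of_tendsto (l := Filter.atTop)
    (F := fun F => weightedShift (e F) c (he F) (Equiv.refl ℤ)) ?_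
    (Filter.Eventually.of_forall hfin)
  rw [Metric.tendsto_atTop]
  intro ε hε
  have hs : {n | ¬ ‖d n‖ < ε / 2}.Finite := by
    have := h0.norm.eventually (gt_mem_nhds (show ‖(0 : ℂ)‖ < ε / 2 by simpa using half_pos hε))
    exact this
  refine ⟨hs.toFinset, fun F hF => ?_⟩
  rw [dist_eq_norm]
  refine lt_of_le_of_lt ?_ (half_lt_self hε)
  have hb : ∀ n, ‖e F n - d n‖ ≤ ε / 2 := fun n => by
    by_cases h : n ∈ F
    · simpa [e, h] using (half_pos hε).le
    · have : ‖d n‖ < ε / 2 := by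
        by_contra h'
        exact h (hF (hs.mem_toFinset.mpr h'))
      simpa [e, h] using this.le
  have : weightedShift (e F) c (he F) (Equiv.refl ℤ) - weightedShift d c hd (Equiv.refl ℤ) =
      weightedShift (fun n => e F n - d n) (ε / 2) hb (Equiv.refl ℤ) := by
    ext a n
    simp [sub_mul]
  rw [this]
  exact norm_weightedShift_le _ _ _ _

/-- A family of diagonal contractions with continuous entries is strongly continuous. -/
theorem continuous_diagonal_apply {X : Type*} [TopologicalSpace X] {d : X → ℤ → ℂ}
    (hd : ∀ x n, ‖d x n‖ ≤ 1) (hcont : ∀ n, Continuous fun x => d x n) {f : X → Seq}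
    (hf : Continuous f) :
    Continuous fun x => weightedShift (d x) 1 (hd x) (Equiv.refl ℤ) (f x) := by
  -- For a fixed vector, contractivity makes the convergence of the finitely supported
  -- approximations uniform in `x`.
  have hc : ∀ a : Seq, Continuous fun x => weightedShift (d x) 1 (hd x) (Equiv.refl ℤ) a := by
    intro a
    have hlim : TendstoUniformly (fun (F : Finset ℤ) x =>
        weightedShift (d x) 1 (hd x) (Equiv.refl ℤ) (∑ i ∈ F, lp.single 2 i (a i)))
        (fun x => weightedShift (d x) 1 (hd x) (Equiv.refl ℤ) a) Filter.atTop := by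
      have ha : Filter.Tendsto (fun F : Finset ℤ => ∑ i ∈ F, lp.single 2 i (a i)) Filter.atTop
        (nhds a) := lp.hasSum_single (by norm_num) a
      rw [Metric.tendstoUniformly_iff]
      rw [Metric.tendsto_nhds] at ha
      intro ε hε
      filter_upwards [ha ε hε] with F hF x
      refine lt_of_le_of_lt ?_ hF
      rw [dist_comm, dist_eq_norm, dist_eq_norm, ← map_sub]
      refine (ContinuousLinearMap.le_opNorm _ _).trans ?_
      exact mul_le_of_le_one_left (norm_nonneg _) (norm_weightedShift_le _ _ _ _)
    refine hlim.continuous (Filter.Frequently.of_forall fun F => ?_)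
    simp only [map_sum]
    refine continuous_finsetSum _ fun i _ => ?_
    have : ∀ x, weightedShift (d x) 1 (hd x) (Equiv.refl ℤ) (lp.single 2 i (a i)) =
        d x i • lp.single 2 i (a i) := fun x => by
      ext n
      by_cases h : n = i
      · subst h; simp
      · simp [h]
    simp only [this]
    exact (hcont i).smul continuous_const
  rw [continuous_iff_continuousAt]
  intro x₀
  rw [ContinuousAt, tendsto_iff_norm_sub_tendsto_zero]
  have h1 : Filter.Tendsto (fun x => ‖f x - f x₀‖ +
      ‖weightedShift (d x) 1 (hd x) (Equiv.refl ℤ) (f x₀) -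
        weightedShift (d x₀) 1 (hd x₀) (Equiv.refl ℤ) (f x₀)‖) (nhds x₀) (nhds 0) := by
    have h2 := tendsto_iff_norm_sub_tendsto_zero.mp (hf.tendsto x₀)
    have h3 := tendsto_iff_norm_sub_tendsto_zero.mp ((hc (f x₀)).tendsto x₀)
    simpa using h2.add h3
  refine squeeze_zero (fun _ => norm_nonneg _) (fun x => ?_) h1
  have h4 : weightedShift (d x) 1 (hd x) (Equiv.refl ℤ) (f x) -
      weightedShift (d x₀) 1 (hd x₀) (Equiv.refl ℤ) (f x₀) =
      weightedShift (d x) 1 (hd x) (Equiv.refl ℤ) (f x - f x₀) +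
      (weightedShift (d x) 1 (hd x) (Equiv.refl ℤ) (f x₀) -
        weightedShift (d x₀) 1 (hd x₀) (Equiv.refl ℤ) (f x₀)) := by
    rw [map_sub]; abel
  rw [h4]
  refine (norm_add_le _ _).trans (add_le_add_left ?_ _)
  refine (ContinuousLinearMap.le_opNorm _ _).trans ?_
  exact mul_le_of_le_one_left (norm_nonneg _) (norm_weightedShift_le _ _ _ _)

/-! ### Sobolev weights and Sobolev spaces -/

theorem sobolevWeight_ne_zero (s : ℝ) (n : ℤ) : (sobolevWeight s n : ℂ) ≠ 0 :=
  Complex.ofReal_ne_zero.mpr (sobolevWeight_pos s n).ne'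

theorem norm_sobolevWeight (s : ℝ) (n : ℤ) : ‖(sobolevWeight s n : ℂ)‖ = sobolevWeight s n := by
  rw [Complex.norm_real, Real.norm_of_nonneg (sobolevWeight_pos s n).le]

theorem sobolevWeight_zero (n : ℤ) : sobolevWeight 0 n = 1 := by simp [sobolevWeight]

theorem sobolevWeight_two (n : ℤ) : sobolevWeight 2 n = 1 + (n : ℝ) ^ 2 := by
  simp [sobolevWeight]

theorem sobolevWeight_add (r s : ℝ) (n : ℤ) :
    sobolevWeight (r + s) n = sobolevWeight r n * sobolevWeight s n := by
  rw [sobolevWeight, add_div, Real.rpow_add (by positivity)]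
  rfl

theorem sobolevWeight_mono {r s : ℝ} (h : r ≤ s) (n : ℤ) :
    sobolevWeight r n ≤ sobolevWeight s n :=
  Real.rpow_le_rpow_of_exponent_le (by nlinarith [sq_nonneg (n : ℝ)]) (by linarith)

theorem one_le_sobolevWeight {s : ℝ} (hs : 0 ≤ s) (n : ℤ) : 1 ≤ sobolevWeight s n :=
  (sobolevWeight_zero n).symm.trans_le (sobolevWeight_mono hs n)

theorem sobolevWeight_one_sq (n : ℤ) : sobolevWeight 1 n ^ 2 = 1 + (n : ℝ) ^ 2 := by
  rw [sq, ← sobolevWeight_add]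
  norm_num [sobolevWeight_two]

/-- Peetre's inequality. -/
theorem sobolevWeight_le_mul {s : ℝ} (hs : 0 ≤ s) (m n : ℤ) :
    sobolevWeight s m ≤ 2 ^ (s / 2) * sobolevWeight s (m - n) * sobolevWeight s n := by
  unfold sobolevWeight
  rw [← Real.mul_rpow (by positivity) (by positivity),
    ← Real.mul_rpow (by positivity) (by positivity)]
  refine Real.rpow_le_rpow (by positivity) ?_ (by positivity)
  push_cast
  -- With `p = m - n`, the difference of the two sides is `1 + (p - n)² + 2p²n²`.
  nlinarith [sq_nonneg ((m : ℝ) - 2 * n), sq_nonneg (((m : ℝ) - n) * n)]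

/-- The isometry of `L²` with `ℓ²(ℤ)` given by the Fourier coefficients. -/
abbrev fourierIso : L2 ≃ₗᵢ[ℂ] Seq := (fourierBasis (T := (1 : ℝ))).repr

theorem fourierIso_apply (u : L2) (n : ℤ) : fourierIso u n = fourierCoeff (u : Torus → ℂ) n :=
  fourierBasis_repr u n

theorem L2.ext_fourierCoeff {u v : L2}
    (h : ∀ n, fourierCoeff (u : Torus → ℂ) n = fourierCoeff (v : Torus → ℂ) n) : u = v := by
  apply fourierIso.injective
  ext n
  simpa only [fourierIso_apply] using h n

theorem mem_sobolevSubmodule {s : ℝ} {u : L2} :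
    u ∈ sobolevSubmodule s ↔ Memℓp (sobolevCoeff s u) 2 := Iff.rfl

theorem sobolevSubmodule_zero : sobolevSubmodule 0 = ⊤ := by
  refine eq_top_iff.mpr fun u _ => ?_
  have h : sobolevCoeff 0 u = fourierIso u := by
    ext n
    rw [sobolevCoeff, sobolevWeight_zero, fourierIso_apply]
    simp
  rw [mem_sobolevSubmodule, h]
  exact lp.memℓp _

theorem sobolevSubmodule_anti {r s : ℝ} (h : r ≤ s) : sobolevSubmodule s ≤ sobolevSubmodule r := by
  intro u hu
  refine Memℓp.mono' hu fun n => ?_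
  rw [sobolevCoeff, sobolevCoeff, norm_mul, norm_mul, norm_sobolevWeight, norm_sobolevWeight]
  exact mul_le_mul_of_nonneg_right (sobolevWeight_mono h n) (norm_nonneg _)

namespace Sobolev

variable {s : ℝ}

theorem toL2_injective : Function.Injective (toL2 : Sobolev s → L2) := Subtype.val_injective

theorem norm_def (u : Sobolev s) : ‖u‖ = ‖coeffs u‖ := rfl

/-- The element of `H^s` given by `u ∈ L²` with `(1 + n²)^{s/2} û(n)` square summable. -/
def mk (u : L2) (hu : u ∈ sobolevSubmodule s) : Sobolev s := ⟨u, hu⟩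

@[simp]
theorem toL2_mk (u : L2) (hu : u ∈ sobolevSubmodule s) : (mk u hu).toL2 = u := rfl

theorem toL2_mem (u : Sobolev s) : u.toL2 ∈ sobolevSubmodule s := u.2

/-- For `s ≥ 0` the inverse weights are at most `1`, so dividing by the weights stays in `ℓ²` and
yields a genuine `L²` function. -/
theorem coeffs_surjective (hs : 0 ≤ s) : Function.Surjective (coeffs : Sobolev s → Seq) := by
  intro b
  have hw : ∀ n : ℤ, ‖((sobolevWeight s n : ℂ))⁻¹‖ ≤ 1 := fun n => by
    rw [norm_inv, norm_sobolevWeight]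
    exact inv_le_one_of_one_le₀ (one_le_sobolevWeight hs n)
  let u : L2 := fourierIso.symm (weightedShift _ 1 hw (Equiv.refl ℤ) b)
  have hu : ∀ n, sobolevCoeff s u n = b n := fun n => by
    rw [sobolevCoeff, ← fourierIso_apply, LinearIsometryEquiv.apply_symm_apply,
      weightedShift_apply, mul_inv_cancel_left₀ (sobolevWeight_ne_zero s n)]
    rfl
  refine ⟨mk u ?_, ?_⟩
  · rw [mem_sobolevSubmodule, funext hu]
    exact lp.memℓp b
  · ext n
    exact hu n

/-- The isometry of `H^s` with `ℓ²(ℤ)` given by the weighted Fourier coefficients. -/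
def coeffsIso (hs : 0 ≤ s) : Sobolev s ≃ₗᵢ[ℂ] Seq :=
  LinearIsometryEquiv.ofSurjective ⟨coeffs, fun _ => rfl⟩ (coeffs_surjective hs)

theorem completeSpace (hs : 0 ≤ s) : CompleteSpace (Sobolev s) :=
  (completeSpace_congr (e := (coeffsIso hs).symm.toEquiv)
    (coeffsIso hs).symm.isometry.isUniformEmbedding).mp inferInstance

end Sobolev

/-- An operator of `L²` whose matrix in the Fourier basis is dominated by a summable convolution
kernel, up to the Sobolev weights, maps `H^s` to `H^r`. -/
theorem exists_sobolev_clm {r s : ℝ} {A : L2 → L2} {M : ℤ → ℤ → ℂ} {k : ℤ → ℝ}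
    (hA : ∀ (u : L2) m, HasSum (fun n => M m n * fourierCoeff (u : Torus → ℂ) n)
      (fourierCoeff (A u : Torus → ℂ) m))
    (hk : Summable k)
    (hM : ∀ m n, sobolevWeight r m * ‖M m n‖ ≤ k (m - n) * sobolevWeight s n) :
    ∃ B : Sobolev s →L[ℂ] Sobolev r, ∀ u, (B u).toL2 = A u.toL2 := by
  -- Conjugation by the weights turns an operator `H^s → H^r` into an operator of `ℓ²`.
  obtain ⟨B, hB⟩ := exists_clm_of_matrix
    (M := fun m n => (sobolevWeight r m : ℂ) * M m n * (sobolevWeight s n : ℂ)⁻¹) hk fun m n => by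
    rw [norm_mul, norm_mul, norm_inv, norm_sobolevWeight, norm_sobolevWeight, ← div_eq_mul_inv,
      div_le_iff₀ (sobolevWeight_pos s n)]
    exact hM m n
  have hco : ∀ (u : Sobolev s) m, sobolevCoeff r (A u.toL2) m = B (Sobolev.coeffs u) m := by
    intro u m
    refine HasSum.unique ((hA u.toL2 m).mul_left _) ?_
    refine (hB (Sobolev.coeffs u) m).congr_fun fun n => ?_
    rw [Sobolev.coeffs_apply]
    have := sobolevWeight_ne_zero s n
    field_simp
  have hmem : ∀ u : Sobolev s, A u.toL2 ∈ sobolevSubmodule r := fun u => by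
    rw [mem_sobolevSubmodule, funext (hco u)]
    exact lp.memℓp _
  have hcoeffs : ∀ u : Sobolev s, Sobolev.coeffs (Sobolev.mk _ (hmem u)) = B (Sobolev.coeffs u) :=
    fun u => lp.ext (funext fun m => hco u m)
  refine ⟨LinearMap.mkContinuous
    { toFun := fun u => Sobolev.mk _ (hmem u)
      map_add' := fun u v => Sobolev.coeffs_injective <|
        (hcoeffs _).trans (by rw [map_add, map_add, map_add, hcoeffs, hcoeffs])
      map_smul' := fun c u => Sobolev.coeffs_injective <|
        (hcoeffs _).trans (by rw [map_smul, map_smul, map_smul, hcoeffs, RingHom.id_apply]) } ‖B‖ fun u => ?_,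
    fun u => rfl⟩
  exact (congrArg norm (hcoeffs u)).trans_le (B.le_opNorm _)

/-! ### Fourier coefficients of smooth functions -/

/-- A function on the torus is smooth if its periodic lift is. -/
abbrev IsSmooth (φ : Torus → ℂ) : Prop := ContDiff ℝ (⊤ : ℕ∞) fun x : ℝ => φ (x : Torus)

/-- The derivative of a function on the torus. -/
def torusDeriv (φ : Torus → ℂ) (x : Torus) : ℂ := deriv (fun h : ℝ => φ (x + (h : Torus))) 0

theorem torusDeriv_coe (φ : Torus → ℂ) (x : ℝ) :
    torusDeriv φ (x : Torus) = deriv (fun y : ℝ => φ (y : Torus)) x := by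
  have h := deriv_comp_const_add (fun y : ℝ => φ (y : Torus)) x 0
  rw [add_zero] at h
  rw [← h, torusDeriv]
  simp only [AddCircle.coe_add]

theorem secondDeriv_eq (φ : Torus → ℂ) : secondDeriv φ = torusDeriv (torusDeriv φ) := by
  funext x
  induction x using QuotientAddGroup.induction_on with | H x => ?_
  rw [torusDeriv_coe]
  simp only [torusDeriv_coe]
  have h := iteratedDeriv_comp_const_add 2 (fun y : ℝ => φ (y : Torus)) x
  have h0 := congrFun h 0
  simp only [add_zero, iteratedDeriv_succ, iteratedDeriv_zero] at h0
  rw [← h0, secondDeriv]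
  simp only [AddCircle.coe_add, iteratedDeriv_succ, iteratedDeriv_zero]

theorem IsSmooth.torusDeriv {φ : Torus → ℂ} (hφ : IsSmooth φ) : IsSmooth (torusDeriv φ) := by
  unfold IsSmooth
  simp only [torusDeriv_coe]
  exact (contDiff_infty_iff_deriv.mp hφ).2

theorem IsSmooth.secondDeriv {φ : Torus → ℂ} (hφ : IsSmooth φ) : IsSmooth (secondDeriv φ) := by
  rw [secondDeriv_eq]
  exact hφ.torusDeriv.torusDeriv

theorem IsSmooth.continuous {φ : Torus → ℂ} (hφ : IsSmooth φ) : Continuous φ :=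
  continuous_quot_lift (f := fun x : ℝ => φ (x : Torus)) (fun a b h => by
    have : (a : Torus) = b := Quotient.sound h
    simp only [this]) (ContDiff.continuous hφ) |>.congr fun x => by
      induction x using QuotientAddGroup.induction_on with | H x => rfl

/-- Integration by parts over one period; the boundary terms cancel by periodicity. -/
theorem fourierCoeff_torusDeriv {φ : Torus → ℂ} (hφ : IsSmooth φ) (n : ℤ) :
    fourierCoeff (torusDeriv φ) n = 2 * Real.pi * Complex.I * n * fourierCoeff φ n := by
  have hd : ∀ x : ℝ, HasDerivAt (fun y : ℝ => φ (y : Torus)) (torusDeriv φ x) x := fun x => by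
    rw [torusDeriv_coe]
    exact (hφ.differentiable (by simp) x).hasDerivAt
  have he : ∀ x : ℝ, HasDerivAt (fun y : ℝ => fourier (-n) (y : Torus))
      (-2 * Real.pi * Complex.I * n / (1 : ℝ) * fourier (-n) (x : Torus)) x :=
    fun x => hasDerivAt_fourier_neg 1 n x
  have hc : Continuous fun y : ℝ => fourier (-n) (y : Torus) :=
    (fourier (-n)).continuous.comp (AddCircle.continuous_mk' 1)
  have hcφ : Continuous fun y : ℝ => φ (y : Torus) := ContDiff.continuous hφ
  have hcd : Continuous fun y : ℝ => torusDeriv φ (y : Torus) := ContDiff.continuous hφ.torusDeriv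
  have h1 := intervalIntegral.integral_eq_sub_of_hasDerivAt (a := 0) (b := 1)
    (fun x _ => (he x).mul (hd x))
    ((((continuous_const.mul hc).mul hcφ).add (hc.mul hcd)).intervalIntegrable _ _)
  have hi1 : IntervalIntegrable (fun y : ℝ => -2 * Real.pi * Complex.I * n / (1 : ℝ) *
      fourier (-n) (y : Torus) * φ (y : Torus)) volume 0 1 :=
    ((continuous_const.mul hc).mul hcφ).intervalIntegrable _ _
  have hi2 : IntervalIntegrable (fun y : ℝ => fourier (-n) (y : Torus) * torusDeriv φ (y : Torus))
      volume 0 1 := (hc.mul hcd).intervalIntegrable _ _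
  rw [intervalIntegral.integral_add hi1 hi2] at h1
  have h2 : ((1 : ℝ) : Torus) = ((0 : ℝ) : Torus) := by
    simp [AddCircle.coe_period]
  simp only [Pi.mul_apply, h2, sub_self, mul_assoc, intervalIntegral.integral_const_mul] at h1
  rw [fourierCoeff_eq_intervalIntegral _ _ 0, fourierCoeff_eq_intervalIntegral _ _ 0]
  simp only [smul_eq_mul, zero_add, one_div, inv_one, one_smul]
  simp only [Complex.ofReal_one, div_one] at h1
  linear_combination h1

theorem fourierCoeff_secondDeriv {φ : Torus → ℂ} (hφ : IsSmooth φ) (n : ℤ) :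
    fourierCoeff (secondDeriv φ) n = -(4 * Real.pi ^ 2 * n ^ 2 : ℝ) * fourierCoeff φ n := by
  rw [secondDeriv_eq, fourierCoeff_torusDeriv hφ.torusDeriv, fourierCoeff_torusDeriv hφ]
  push_cast
  linear_combination (4 * Real.pi ^ 2 * n ^ 2 * fourierCoeff φ n) * Complex.I_sq

theorem exists_norm_fourierCoeff_le {φ : Torus → ℂ} (hφ : Continuous φ) :
    ∃ A, ∀ n, ‖fourierCoeff φ n‖ ≤ A := by
  obtain ⟨A, hA⟩ := isCompact_univ.exists_bound_of_continuousOn hφ.continuousOn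
  refine ⟨A, fun n => ?_⟩
  have h := norm_integral_le_of_norm_le_const (μ := torusMeasure) (C := A)
    (f := fun t => fourier (-n) t • φ t) (Filter.Eventually.of_forall fun x => by
      rw [norm_smul]
      refine (mul_le_of_le_one_left (norm_nonneg _) ?_).trans (hA x (Set.mem_univ x))
      exact ((fourier (-n)).norm_coe_le_norm x).trans (fourier_norm _).le)
  simpa [fourierCoeff] using h

/-- Each factor `1 + n²` is paid for by passing from `φ` to `φ''`, which is again smooth; this is
why the induction quantifies over all `φ`. -/
theorem exists_pow_mul_norm_fourierCoeff_le (j : ℕ) :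
    ∀ {φ : Torus → ℂ}, IsSmooth φ → ∃ A, ∀ n : ℤ, (1 + (n : ℝ) ^ 2) ^ j * ‖fourierCoeff φ n‖ ≤ A := by
  induction j with
  | zero => exact fun hφ => by simpa using exists_norm_fourierCoeff_le hφ.continuous
  | succ j ih =>
    intro φ hφ
    obtain ⟨A, hA⟩ := ih hφ
    obtain ⟨B, hB⟩ := ih hφ.secondDeriv
    refine ⟨A + B, fun n => ?_⟩
    have h1 : (n : ℝ) ^ 2 * ‖fourierCoeff φ n‖ ≤ ‖fourierCoeff (secondDeriv φ) n‖ := by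
      rw [fourierCoeff_secondDeriv hφ, norm_mul, norm_neg, Complex.norm_real,
        Real.norm_of_nonneg (by positivity)]
      refine mul_le_mul_of_nonneg_right ?_ (norm_nonneg _)
      have : 1 ≤ 4 * Real.pi ^ 2 := by nlinarith [Real.pi_gt_three]
      exact le_mul_of_one_le_left (sq_nonneg _) this
    calc (1 + (n : ℝ) ^ 2) ^ (j + 1) * ‖fourierCoeff φ n‖
        = (1 + (n : ℝ) ^ 2) ^ j * ‖fourierCoeff φ n‖ +
          (1 + (n : ℝ) ^ 2) ^ j * ((n : ℝ) ^ 2 * ‖fourierCoeff φ n‖) := by ring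
      _ ≤ A + B := add_le_add (hA n)
        ((mul_le_mul_of_nonneg_left h1 (by positivity)).trans (hB n))

theorem summable_inv_one_add_sq : Summable fun n : ℤ => (1 + (n : ℝ) ^ 2)⁻¹ := by
  have h : Summable fun n : ℤ => ((n : ℝ) ^ 2)⁻¹ := by
    simpa using (Real.summable_one_div_int_pow (p := 2)).mpr (by norm_num)
  refine Summable.of_norm_bounded_eventually h ?_
  filter_upwards [(Set.finite_singleton (0 : ℤ)).compl_mem_cofinite] with n hn
  have hn' : (n : ℝ) ≠ 0 := by simpa using hn
  rw [Real.norm_of_nonneg (by positivity)]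
  gcongr
  linarith

/-- The Fourier coefficients of a smooth function decay rapidly. -/
theorem summable_sobolevWeight_mul_fourierCoeff {φ : Torus → ℂ} (hφ : IsSmooth φ) (s : ℝ) :
    Summable fun n => sobolevWeight s n * ‖fourierCoeff φ n‖ := by
  obtain ⟨j, hj⟩ := exists_nat_ge (s / 2)
  obtain ⟨A, hA⟩ := exists_pow_mul_norm_fourierCoeff_le (j + 1) hφ
  refine (summable_inv_one_add_sq.mul_left A).of_nonneg_of_le
    (fun n => mul_nonneg (sobolevWeight_pos s n).le (norm_nonneg _)) fun n => ?_
  rw [← div_eq_mul_inv, le_div_iff₀ (by positivity)]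
  refine le_trans ?_ (hA n)
  have h1 : sobolevWeight s n ≤ (1 + (n : ℝ) ^ 2) ^ j := by
    rw [sobolevWeight, ← Real.rpow_natCast (1 + (n : ℝ) ^ 2) j]
    exact Real.rpow_le_rpow_of_exponent_le (le_add_of_nonneg_right (sq_nonneg _)) hj
  calc sobolevWeight s n * ‖fourierCoeff φ n‖ * (1 + (n : ℝ) ^ 2)
      ≤ (1 + (n : ℝ) ^ 2) ^ j * ‖fourierCoeff φ n‖ * (1 + (n : ℝ) ^ 2) := by gcongr
    _ = _ := by ring

/-! ### Multiplication operators and pairings in the Fourier basis -/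

/-- The exponential `e^{2πinx}` as an element of `L²`. -/
abbrev expL2 (n : ℤ) : L2 := fourierLp (T := (1 : ℝ)) 2 n

theorem hasSum_clm_apply (A : L2 →L[ℂ] ℂ) (u : L2) :
    HasSum (fun n => A (expL2 n) * fourierCoeff (u : Torus → ℂ) n) (A u) := by
  have h := (hasSum_fourier_series_L2 u).mapL A
  simpa only [map_smul, smul_eq_mul, mul_comm] using h

/-- The `n`-th Fourier coefficient as a continuous linear form on `L²`. -/
def coeffCLM (n : ℤ) : L2 →L[ℂ] ℂ :=
  (lp.evalCLM ℂ (fun _ : ℤ => ℂ) 2 n).comp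
    (fourierIso.toContinuousLinearEquiv : L2 →L[ℂ] Seq)

theorem coeffCLM_apply (n : ℤ) (u : L2) : coeffCLM n u = fourierCoeff (u : Torus → ℂ) n :=
  fourierIso_apply u n

theorem hasSum_fourierCoeff_clm (A : L2 →L[ℂ] L2) (u : L2) (m : ℤ) :
    HasSum (fun n => fourierCoeff (A (expL2 n) : Torus → ℂ) m * fourierCoeff (u : Torus → ℂ) n)
      (fourierCoeff (A u : Torus → ℂ) m) := by
  simpa only [ContinuousLinearMap.comp_apply, coeffCLM_apply] using
    hasSum_clm_apply ((coeffCLM m).comp A) u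

theorem coe_mulOp (χ : C(Torus, ℝ)) (u : L2) :
    (mulOp χ u : Torus → ℂ) =ᵐ[torusMeasure] fun x => (χ x : ℂ) * u x :=
  MemLp.coeFn_toLp _

/-- Multiplication by a continuous function as a continuous linear operator of `L²`. -/
def mulCLM (χ : C(Torus, ℝ)) : L2 →L[ℂ] L2 :=
  LinearMap.mkContinuous
    { toFun := mulOp χ
      map_add' := fun u v => by
        apply Lp.ext
        filter_upwards [coe_mulOp χ (u + v), coe_mulOp χ u, coe_mulOp χ v, Lp.coeFn_add u v,
          Lp.coeFn_add (mulOp χ u) (mulOp χ v)] with x h1 h2 h3 h4 h5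
        rw [h1, h4, h5, Pi.add_apply, Pi.add_apply, h2, h3, mul_add]
      map_smul' := fun c u => by
        apply Lp.ext
        filter_upwards [coe_mulOp χ (c • u), coe_mulOp χ u, Lp.coeFn_smul c u,
          Lp.coeFn_smul c (mulOp χ u)] with x h1 h2 h3 h4
        rw [h1, h3, RingHom.id_apply, h4, Pi.smul_apply, Pi.smul_apply, h2, smul_eq_mul,
          smul_eq_mul, mul_left_comm] } ‖χ‖ fun u => by
    refine Lp.norm_le_mul_norm_of_ae_le_mul ?_
    filter_upwards [coe_mulOp χ u] with x hx
    change ‖(mulOp χ u : Torus → ℂ) x‖ ≤ _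
    rw [hx, norm_mul, Complex.norm_real]
    exact mul_le_mul_of_nonneg_right (χ.norm_coe_le_norm x) (norm_nonneg _)

@[simp]
theorem mulCLM_apply (χ : C(Torus, ℝ)) (u : L2) : mulCLM χ u = mulOp χ u := rfl

theorem mulOp_mulOp (χ : C(Torus, ℝ)) (u : L2) : mulOp χ (mulOp χ u) = mulOp (χ ^ 2) u := by
  apply Lp.ext
  filter_upwards [coe_mulOp χ (mulOp χ u), coe_mulOp χ u, coe_mulOp (χ ^ 2) u] with x h1 h2 h3
  rw [h1, h2, h3]
  simp only [ContinuousMap.pow_apply]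
  push_cast
  ring

theorem inner_mulOp_left (χ : C(Torus, ℝ)) (u v : L2) :
    inner ℂ (mulOp χ u) v = inner ℂ u (mulOp χ v) := by
  rw [L2.inner_def, L2.inner_def]
  refine integral_congr_ae ?_
  filter_upwards [coe_mulOp χ u, coe_mulOp χ v] with x h1 h2
  rw [h1, h2]
  simp only [RCLike.inner_apply, map_mul, Complex.conj_ofReal]
  ring

theorem fourierCoeff_mulOp_expL2 (χ : C(Torus, ℝ)) (m n : ℤ) :
    fourierCoeff (mulOp χ (expL2 n) : Torus → ℂ) m = fourierCoeff (fun x => (χ x : ℂ)) (m - n) := by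
  refine integral_congr_ae ?_
  filter_upwards [coe_mulOp χ (expL2 n), coeFn_fourierLp (T := (1 : ℝ)) 2 n] with x h1 h2
  rw [h1, h2, neg_sub, sub_eq_add_neg, fourier_add]
  simp only [smul_eq_mul]
  ring

theorem hasSum_fourierCoeff_mulOp (χ : C(Torus, ℝ)) (u : L2) (m : ℤ) :
    HasSum (fun n => fourierCoeff (fun x => (χ x : ℂ)) (m - n) * fourierCoeff (u : Torus → ℂ) n)
      (fourierCoeff (mulOp χ u : Torus → ℂ) m) := by
  simpa only [mulCLM_apply, fourierCoeff_mulOp_expL2] using hasSum_fourierCoeff_clm (mulCLM χ) u m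

/-- The complex conjugate of a continuous function, as an element of `L²`. -/
def conjL2 (φ : C(Torus, ℂ)) : L2 := ContinuousMap.toLp 2 torusMeasure ℂ (star φ)

/-- The weak formulation pairs bilinearly. Conjugating the test function turns the pairing into an
inner product, so that the unitary group can be moved across it. -/
theorem inner_conjL2 (φ : C(Torus, ℂ)) (u : L2) :
    inner ℂ (conjL2 φ) u = ∫ x, u x * φ x ∂torusMeasure := by
  have h : (conjL2 φ : Torus → ℂ) =ᵐ[torusMeasure] star φ := ContinuousMap.coeFn_toLp _ _
  rw [L2.inner_def]
  refine integral_congr_ae ?_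
  filter_upwards [h] with x hx
  rw [hx, RCLike.inner_apply]
  simp

theorem fourierCoeff_conjL2 (φ : C(Torus, ℂ)) (n : ℤ) :
    fourierCoeff (conjL2 φ : Torus → ℂ) n = starRingEnd ℂ (fourierCoeff φ (-n)) := by
  rw [conjL2, fourierCoeff_toLp, fourierCoeff, fourierCoeff, ← integral_conj]
  refine integral_congr_ae (Filter.Eventually.of_forall fun x => ?_)
  simp only [smul_eq_mul, map_mul, neg_neg, fourier_neg]
  rfl

/-! ### The Schrödinger group -/

/-- The `n`-th Fourier multiplier `e^{-4π²in²t}` of the Schrödinger group. -/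
def phase (t : ℝ) (n : ℤ) : ℂ :=
  Complex.exp (-(4 * Real.pi ^ 2 * (n : ℝ) ^ 2 * t : ℝ) * Complex.I)

theorem norm_phase (t : ℝ) (n : ℤ) : ‖phase t n‖ = 1 := by
  rw [phase, ← Complex.ofReal_neg, Complex.norm_exp_ofReal_mul_I]

theorem phase_zero (n : ℤ) : phase 0 n = 1 := by simp [phase]

theorem phase_add (s t : ℝ) (n : ℤ) : phase (s + t) n = phase s n * phase t n := by
  rw [phase, phase, phase, ← Complex.exp_add]
  congr 1
  push_cast
  ring

theorem phase_neg_mul_phase (t : ℝ) (n : ℤ) : phase (-t) n * phase t n = 1 := by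
  rw [← phase_add, neg_add_cancel, phase_zero]

theorem hasDerivAt_phase (n : ℤ) (t : ℝ) :
    HasDerivAt (fun t => phase t n)
      (-(4 * Real.pi ^ 2 * (n : ℝ) ^ 2 : ℝ) * Complex.I * phase t n) t := by
  have h1 : HasDerivAt (fun t : ℝ => (4 * Real.pi ^ 2 * (n : ℝ) ^ 2 * t : ℝ))
      (4 * Real.pi ^ 2 * (n : ℝ) ^ 2) t := by
    simpa using (hasDerivAt_id t).const_mul (4 * Real.pi ^ 2 * (n : ℝ) ^ 2)
  have h2 := ((h1.ofReal_comp).neg.mul_const Complex.I).cexp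
  exact h2.congr_deriv (mul_comm _ _)

theorem continuous_phase (n : ℤ) : Continuous fun t => phase t n :=
  continuous_iff_continuousAt.mpr fun t => (hasDerivAt_phase n t).continuousAt

theorem fourierCoeff_flow (t : ℝ) (u : L2) (n : ℤ) :
    fourierCoeff (schrodingerFlow t u : Torus → ℂ) n =
      phase t n * fourierCoeff (u : Torus → ℂ) n := fourierCoeff_schrodingerFlow t u n

theorem schrodingerFlow_eq (t : ℝ) (u : L2) :
    schrodingerFlow t u = fourierIso.symm
      (weightedShift (phase t) 1 (fun n => (norm_phase t n).le) (Equiv.refl ℤ) (fourierIso u)) :=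
  rfl

theorem flow_flow (s t : ℝ) (u : L2) :
    schrodingerFlow s (schrodingerFlow t u) = schrodingerFlow (s + t) u :=
  L2.ext_fourierCoeff fun n => by simp only [fourierCoeff_flow, phase_add, mul_assoc]

theorem flow_zero (u : L2) : schrodingerFlow 0 u = u :=
  L2.ext_fourierCoeff fun n => by rw [fourierCoeff_flow, phase_zero, one_mul]

theorem norm_sq_eq_tsum_fourierCoeff (u : L2) :
    ‖u‖ ^ 2 = ∑' n, ‖fourierCoeff (u : Torus → ℂ) n‖ ^ 2 := by
  rw [← fourierIso.norm_map u, norm_sq_eq_tsum]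
  simp only [fourierIso_apply]

theorem norm_flow (t : ℝ) (u : L2) : ‖schrodingerFlow t u‖ = ‖u‖ := by
  rw [← sq_eq_sq₀ (norm_nonneg _) (norm_nonneg _), norm_sq_eq_tsum_fourierCoeff,
    norm_sq_eq_tsum_fourierCoeff]
  simp only [fourierCoeff_flow, norm_mul, norm_phase, one_mul]

/-- The Schrödinger flow at time `t` as a linear isometry of `L²`. -/
def flowLI (t : ℝ) : L2 →ₗᵢ[ℂ] L2 where
  toFun := schrodingerFlow t
  map_add' u v := by simp only [schrodingerFlow_eq, map_add]
  map_smul' c u := by simp only [schrodingerFlow_eq, map_smul, RingHom.id_apply]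
  norm_map' := norm_flow t

@[simp]
theorem flowLI_apply (t : ℝ) (u : L2) : flowLI t u = schrodingerFlow t u := rfl

theorem inner_flow_left (t : ℝ) (u v : L2) :
    inner ℂ (schrodingerFlow t u) v = inner ℂ u (schrodingerFlow (-t) v) := by
  have h := (flowLI t).inner_map_map u (schrodingerFlow (-t) v)
  rwa [flowLI_apply, flowLI_apply, flow_flow, add_neg_cancel, flow_zero] at h

theorem continuous_flow {X : Type*} [TopologicalSpace X] {τ : X → ℝ} (hτ : Continuous τ)
    {f : X → L2} (hf : Continuous f) : Continuous fun x => schrodingerFlow (τ x) (f x) := by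
  simp only [schrodingerFlow_eq]
  exact fourierIso.symm.continuous.comp (continuous_diagonal_apply
    (fun x n => (norm_phase (τ x) n).le) (fun n => (continuous_phase n).comp hτ)
    (fourierIso.continuous.comp hf))

theorem continuous_flow_apply (u : L2) : Continuous fun t => schrodingerFlow t u :=
  continuous_flow continuous_id continuous_const

theorem continuous_mulOp {X : Type*} [TopologicalSpace X] (χ : C(Torus, ℝ)) {f : X → L2}
    (hf : Continuous f) : Continuous fun x => mulOp χ (f x) := (mulCLM χ).continuous.comp hf

/-- The flow is differentiable in `L²` on data with `∂ₓ² u ∈ L²`. -/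
theorem hasDerivAt_flow {u v : L2}
    (h : ∀ n, fourierCoeff (v : Torus → ℂ) n =
      -(4 * Real.pi ^ 2 * (n : ℝ) ^ 2 : ℝ) * fourierCoeff (u : Torus → ℂ) n) (t : ℝ) :
    HasDerivAt (fun t => schrodingerFlow t u) (schrodingerFlow t (Complex.I • v)) t := by
  have hc := continuous_flow_apply (Complex.I • v)
  -- The integrated equation can be checked one Fourier coefficient at a time; the `L²` derivative
  -- then follows from the fundamental theorem of calculus.
  have hint : ∀ t, schrodingerFlow t u =
      u + ∫ τ in (0 : ℝ)..t, schrodingerFlow τ (Complex.I • v) := by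
    intro t
    refine L2.ext_fourierCoeff fun n => ?_
    rw [fourierCoeff_add, ← coeffCLM_apply n (∫ τ in (0 : ℝ)..t, _),
      ← (coeffCLM n).intervalIntegral_comp_comm (hc.intervalIntegrable _ _)]
    simp only [coeffCLM_apply, fourierCoeff_flow, fourierCoeff_smul, h]
    have h1 := intervalIntegral.integral_eq_sub_of_hasDerivAt (a := 0) (b := t)
      (fun τ _ => (hasDerivAt_phase n τ).mul_const (fourierCoeff (u : Torus → ℂ) n))
      (((continuous_const.mul (continuous_phase n)).mul continuous_const).intervalIntegrable _ _)
    rw [phase_zero, one_mul] at h1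
    have h2 : ∀ τ, phase τ n * (Complex.I * (-(4 * Real.pi ^ 2 * (n : ℝ) ^ 2 : ℝ) *
        fourierCoeff (u : Torus → ℂ) n)) = -(4 * Real.pi ^ 2 * (n : ℝ) ^ 2 : ℝ) * Complex.I *
        phase τ n * fourierCoeff (u : Torus → ℂ) n := fun τ => by ring
    simp only [h2, h1]
    ring
  simp only [hint _]
  exact (hc.integral_hasStrictDerivAt 0 t).hasDerivAt.const_add u

theorem exists_sobolev_flow {s : ℝ} (hs : 0 ≤ s) (u : Sobolev s) :
    ∃ v : ℝ → Sobolev s, Continuous v ∧ (∀ t, (v t).toL2 = schrodingerFlow t u.toL2) ∧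
      ∀ t, ‖v t‖ ≤ ‖u‖ := by
  let v : ℝ → Sobolev s := fun t => (Sobolev.coeffsIso hs).symm
    (weightedShift (phase t) 1 (fun n => (norm_phase t n).le) (Equiv.refl ℤ) (Sobolev.coeffs u))
  have hv : ∀ t, Sobolev.coeffs (v t) = weightedShift (phase t) 1
      (fun n => (norm_phase t n).le) (Equiv.refl ℤ) (Sobolev.coeffs u) := fun t =>
    (Sobolev.coeffsIso hs).apply_symm_apply _
  refine ⟨v, ?_, fun t => L2.ext_fourierCoeff fun n => ?_, fun t => ?_⟩
  · exact (Sobolev.coeffsIso hs).symm.continuous.comp (continuous_diagonal_apply _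
      continuous_phase continuous_const)
  · have h := congrArg (fun a : Seq => a n) (hv t)
    simp only [Sobolev.coeffs_apply, weightedShift_apply, Equiv.refl_apply] at h
    rw [fourierCoeff_flow]
    refine mul_left_cancel₀ (sobolevWeight_ne_zero s n) ?_
    rw [h]
    ring
  · rw [Sobolev.norm_def, Sobolev.norm_def, hv]
    exact (ContinuousLinearMap.le_opNorm _ _).trans
      (mul_le_of_le_one_left (norm_nonneg _) (norm_weightedShift_le _ _ _ _))

/-! ### The HUM operator -/

theorem continuous_humIntegrand (χ : C(Torus, ℝ)) (u : L2) :
    Continuous fun t => schrodingerFlow (-t) (mulOp (χ ^ 2) (schrodingerFlow t u)) :=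
  continuous_flow continuous_neg (continuous_mulOp _ (continuous_flow_apply u))

/-- The HUM operator as a continuous linear operator of `L²`. -/
def humCLM (T : ℝ) (χ : C(Torus, ℝ)) : L2 →L[ℂ] L2 :=
  LinearMap.mkContinuous
    { toFun := humOperator T χ
      map_add' := fun u v => by
        unfold humOperator
        rw [← intervalIntegral.integral_add ((continuous_humIntegrand χ u).intervalIntegrable _ _)
          ((continuous_humIntegrand χ v).intervalIntegrable _ _)]
        simp only [← flowLI_apply, ← mulCLM_apply, map_add]
      map_smul' := fun c u => by
        unfold humOperator
        rw [RingHom.id_apply, ← intervalIntegral.integral_smul]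
        simp only [← flowLI_apply, ← mulCLM_apply, map_smul] } (‖mulCLM (χ ^ 2)‖ * |T|) fun u => by
    refine (intervalIntegral.norm_integral_le_of_norm_le_const (C := ‖mulCLM (χ ^ 2)‖ * ‖u‖)
      fun t _ => ?_).trans_eq (by rw [sub_zero]; ring)
    rw [norm_flow, ← mulCLM_apply]
    refine ((mulCLM (χ ^ 2)).le_opNorm _).trans_eq ?_
    rw [norm_flow]

theorem humCLM_apply (T : ℝ) (χ : C(Torus, ℝ)) (u : L2) : humCLM T χ u = humOperator T χ u := rfl

/-! ### Matrix of the HUM operator and its off-diagonal decay -/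

/-- The function `χ` as a complex valued function. -/
abbrev toComplex (χ : C(Torus, ℝ)) (x : Torus) : ℂ := χ x

theorem isSmooth_toComplex {χ : C(Torus, ℝ)}
    (hχ : ContDiff ℝ (⊤ : ℕ∞) (fun x : ℝ => χ (x : Torus))) : IsSmooth (toComplex χ) :=
  Complex.ofRealCLM.contDiff.comp hχ

theorem isSmooth_toComplex_sq {χ : C(Torus, ℝ)}
    (hχ : ContDiff ℝ (⊤ : ℕ∞) (fun x : ℝ => χ (x : Torus))) : IsSmooth (toComplex (χ ^ 2)) :=
  isSmooth_toComplex (χ := χ ^ 2) (hχ.pow 2)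

/-- The integral `∫₀ᵀ e^{4π²ijt} dt`. -/
def oscIntegral (T : ℝ) (j : ℤ) : ℂ :=
  ∫ t in (0 : ℝ)..T, Complex.exp (4 * Real.pi ^ 2 * j * Complex.I * t)

theorem norm_exp_oscillation (j : ℤ) (t : ℝ) :
    ‖Complex.exp (4 * Real.pi ^ 2 * j * Complex.I * t)‖ = 1 := by
  rw [← Complex.norm_exp_ofReal_mul_I (4 * Real.pi ^ 2 * j * t)]
  congr 2
  push_cast
  ring

theorem oscIntegral_zero (T : ℝ) : oscIntegral T 0 = T := by simp [oscIntegral]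

theorem norm_oscIntegral_le {T : ℝ} (hT : 0 ≤ T) (j : ℤ) : ‖oscIntegral T j‖ ≤ T := by
  refine (intervalIntegral.norm_integral_le_of_norm_le_const
    fun t _ => (norm_exp_oscillation j t).le).trans_eq ?_
  rw [sub_zero, one_mul, abs_of_nonneg hT]

/-- The exponential integrates explicitly to a numerator of modulus at most `2` over `4π²|j|`. The
bound is uniform in `T`. -/
theorem norm_oscIntegral_mul_le (T : ℝ) (j : ℤ) (hj : j ≠ 0) :
    |(j : ℝ)| * ‖oscIntegral T j‖ ≤ 1 := by
  have hj' : (j : ℂ) ≠ 0 := by exact_mod_cast hj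
  have hc : (4 * Real.pi ^ 2 * j * Complex.I : ℂ) ≠ 0 := by
    simp [hj', Real.pi_ne_zero]
  have hn : ‖(4 * Real.pi ^ 2 * j * Complex.I : ℂ)‖ = 4 * Real.pi ^ 2 * |(j : ℝ)| := by
    simp
  have hpos : 0 < |(j : ℝ)| := abs_pos.mpr (by exact_mod_cast hj)
  rw [oscIntegral, integral_exp_mul_complex hc, norm_div, hn]
  have h2 : ‖Complex.exp (4 * Real.pi ^ 2 * j * Complex.I * T) -
      Complex.exp (4 * Real.pi ^ 2 * j * Complex.I * (0 : ℝ))‖ ≤ 2 := by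
    refine (norm_sub_le _ _).trans_eq ?_
    rw [norm_exp_oscillation, norm_exp_oscillation]
    norm_num
  rw [← mul_div_assoc, div_le_one (by positivity)]
  have hpi : 2 ≤ 4 * Real.pi ^ 2 := by nlinarith [Real.pi_gt_three]
  nlinarith

theorem fourierCoeff_humCLM_expL2 (T : ℝ) (χ : C(Torus, ℝ)) (m n : ℤ) :
    fourierCoeff (humCLM T χ (expL2 n) : Torus → ℂ) m =
      fourierCoeff (toComplex (χ ^ 2)) (m - n) * oscIntegral T (m ^ 2 - n ^ 2) := by
  have hflow : ∀ t, schrodingerFlow t (expL2 n) = phase t n • expL2 n := fun t =>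
    L2.ext_fourierCoeff fun j => by
      rw [fourierCoeff_flow, fourierCoeff_smul]
      by_cases hj : j = n
      · rw [hj]
      · have : fourierCoeff (expL2 n : Torus → ℂ) j = 0 := by
          rw [fourierCoeff_toLp, fourierCoeff_fourier, Pi.single_apply, if_neg hj]
        rw [this, mul_zero, mul_zero]
  rw [humCLM_apply, humOperator, ← coeffCLM_apply,
    ← (coeffCLM m).intervalIntegral_comp_comm
      ((continuous_humIntegrand χ _).intervalIntegrable _ _), oscIntegral,
    ← intervalIntegral.integral_const_mul]
  refine intervalIntegral.integral_congr fun t _ => ?_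
  simp only [coeffCLM_apply, fourierCoeff_flow, hflow]
  rw [← mulCLM_apply, map_smul, fourierCoeff_smul, mulCLM_apply, fourierCoeff_mulOp_expL2,
    mul_left_comm, mul_comm (phase t n), mul_comm (phase (-t) m), mul_assoc]
  congr 1
  rw [phase, phase, ← Complex.exp_add]
  congr 1
  push_cast
  ring

/-- The average of the square of the control function. -/
abbrev meanSq (χ : C(Torus, ℝ)) : ℂ := fourierCoeff (toComplex (χ ^ 2)) 0

/-- The HUM operator minus its constant diagonal part. -/
def humRemainder (T : ℝ) (χ : C(Torus, ℝ)) : L2 →L[ℂ] L2 :=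
  humCLM T χ - (T * meanSq χ) • ContinuousLinearMap.id ℂ L2

theorem humRemainder_apply (T : ℝ) (χ : C(Torus, ℝ)) (u : L2) :
    humRemainder T χ u = humCLM T χ u - (T * meanSq χ) • u := by
  simp [humRemainder]

/-- The matrix of `humRemainder` in the Fourier basis. -/
def humMatrix (T : ℝ) (χ : C(Torus, ℝ)) (m n : ℤ) : ℂ :=
  if m = n then 0 else fourierCoeff (toComplex (χ ^ 2)) (m - n) * oscIntegral T (m ^ 2 - n ^ 2)

theorem hasSum_fourierCoeff_humRemainder (T : ℝ) (χ : C(Torus, ℝ)) (u : L2) (m : ℤ) :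
    HasSum (fun n => humMatrix T χ m n * fourierCoeff (u : Torus → ℂ) n)
      (fourierCoeff (humRemainder T χ u : Torus → ℂ) m) := by
  have h1 := hasSum_fourierCoeff_clm (humCLM T χ) u m
  have h2 := hasSum_ite_eq m (T * meanSq χ * fourierCoeff (u : Torus → ℂ) m)
  have h3 : fourierCoeff (humRemainder T χ u : Torus → ℂ) m =
      fourierCoeff (humCLM T χ u : Torus → ℂ) m -
        T * meanSq χ * fourierCoeff (u : Torus → ℂ) m := by
    rw [humRemainder_apply, ← coeffCLM_apply, map_sub, map_smul, coeffCLM_apply, coeffCLM_apply,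
      smul_eq_mul]
  rw [h3]
  refine (h1.sub h2).congr_fun fun n => ?_
  rw [fourierCoeff_humCLM_expL2, humMatrix]
  by_cases h : n = m
  · subst h
    simp only [if_true, sub_self, oscIntegral_zero]
    ring
  · rw [if_neg h, if_neg (Ne.symm h), sub_zero]

/-- This is the source of the gain of one derivative. If `m = -n` there is no oscillation, but
`|m-n| = 2|m|` controls the weight at the cost of the factor `T`. Otherwise `m² - n²` is a non-zero
integer of size at least comparable to `|m|`, and oscillation gives the bound `2`. -/
theorem sobolevWeight_one_mul_norm_oscIntegral_le {T : ℝ} (hT : 0 ≤ T) {m n : ℤ} (h : m ≠ n) :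
    sobolevWeight 1 m * ‖oscIntegral T (m ^ 2 - n ^ 2)‖ ≤ (T + 2) * sobolevWeight 1 (m - n) := by
  by_cases h' : m + n = 0
  · have hn : n = -m := by omega
    have h1 : sobolevWeight 1 m ≤ sobolevWeight 1 (m - n) := by
      refine le_of_sq_le_sq ?_ (sobolevWeight_pos _ _).le
      rw [sobolevWeight_one_sq, sobolevWeight_one_sq, hn]
      push_cast
      nlinarith [sq_nonneg (m : ℝ)]
    have h2 := norm_oscIntegral_le hT (m ^ 2 - n ^ 2)
    calc _ ≤ sobolevWeight 1 (m - n) * T :=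
          mul_le_mul h1 h2 (norm_nonneg _) (sobolevWeight_pos _ _).le
      _ ≤ _ := by nlinarith [sobolevWeight_pos 1 (m - n)]
  · have hq : m - n ≠ 0 := sub_ne_zero.mpr h
    have hj : m ^ 2 - n ^ 2 ≠ 0 := by
      rw [sq_sub_sq]
      exact mul_ne_zero h' hq
    have hp2 : (1 : ℝ) ≤ ((m : ℝ) + n) ^ 2 := by
      have : (1 : ℤ) ≤ (m + n) ^ 2 := Int.add_one_le_of_lt (sq_pos_of_ne_zero ‹_›)
      exact_mod_cast this
    have hq2 : (1 : ℝ) ≤ ((m : ℝ) - n) ^ 2 := by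
      have : (1 : ℤ) ≤ (m - n) ^ 2 := Int.add_one_le_of_lt (sq_pos_of_ne_zero ‹_›)
      exact_mod_cast this
    have h1 : sobolevWeight 1 m ≤ 2 * |((m ^ 2 - n ^ 2 : ℤ) : ℝ)| := by
      refine le_of_sq_le_sq ?_ (by positivity)
      rw [sobolevWeight_one_sq, mul_pow, sq_abs]
      push_cast
      have h3 : (m : ℝ) ^ 2 - n ^ 2 = (m + n) * (m - n) := by ring
      have h4 : (m : ℝ) = ((m + n) + (m - n)) / 2 := by ring
      rw [h3, mul_pow]
      -- With `p = m + n` and `q = m - n`, one has `m² ≤ (p² + q²)/2`, while `(p² - 1)(q² - 1) ≥ 0`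
      -- gives `p² + q² ≤ p²q² + 1`.
      nlinarith [mul_nonneg (sub_nonneg.mpr hp2) (sub_nonneg.mpr hq2),
        sq_nonneg (n : ℝ)]
    have h2 := norm_oscIntegral_mul_le T _ hj
    have h3 : sobolevWeight 1 m * ‖oscIntegral T (m ^ 2 - n ^ 2)‖ ≤ 2 := by
      calc _ ≤ 2 * |((m ^ 2 - n ^ 2 : ℤ) : ℝ)| * ‖oscIntegral T (m ^ 2 - n ^ 2)‖ := by gcongr
        _ ≤ 2 := by rw [mul_assoc]; linarith
    have h4 := one_le_sobolevWeight zero_le_one (m - n)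
    nlinarith

theorem sobolevWeight_one_mul_norm_humMatrix_le {T : ℝ} (hT : 0 ≤ T) (χ : C(Torus, ℝ)) (m n : ℤ) :
    sobolevWeight 1 m * ‖humMatrix T χ m n‖ ≤
      (T + 2) * (sobolevWeight 1 (m - n) * ‖fourierCoeff (toComplex (χ ^ 2)) (m - n)‖) := by
  by_cases h : m = n
  · rw [humMatrix, if_pos h, norm_zero, mul_zero]
    exact mul_nonneg (by linarith) (mul_nonneg (sobolevWeight_pos _ _).le (norm_nonneg _))
  · rw [humMatrix, if_neg h, norm_mul]
    have := mul_le_mul_of_nonneg_right (sobolevWeight_one_mul_norm_oscIntegral_le hT h)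
      (norm_nonneg (fourierCoeff (toComplex (χ ^ 2)) (m - n)))
    linarith

/-! ### Smoothing of the remainder, compactness and regularity -/

section Smooth

variable {T : ℝ} {χ : C(Torus, ℝ)}

/-- The remainder of the HUM operator gains one derivative. -/
theorem exists_sobolev_humRemainder (hT : 0 ≤ T)
    (hχ : ContDiff ℝ (⊤ : ℕ∞) (fun x : ℝ => χ (x : Torus))) {s : ℝ} (hs : 0 ≤ s) :
    ∃ B : Sobolev s →L[ℂ] Sobolev (s + 1), ∀ u, (B u).toL2 = humRemainder T χ u.toL2 := by
  refine exists_sobolev_clm (hasSum_fourierCoeff_humRemainder T χ)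
    ((summable_sobolevWeight_mul_fourierCoeff (isSmooth_toComplex_sq hχ) (s + 1)).mul_left
      (2 ^ (s / 2) * (T + 2))) fun m n => ?_
  have h1 := sobolevWeight_le_mul hs m n
  have h2 := sobolevWeight_one_mul_norm_humMatrix_le hT χ m n
  rw [sobolevWeight_add, sobolevWeight_add, mul_assoc]
  refine (mul_le_mul h1 h2 (mul_nonneg (sobolevWeight_pos _ _).le (norm_nonneg _)) ?_).trans_eq ?_
  · have := sobolevWeight_pos s n
    have := sobolevWeight_pos s (m - n)
    positivity
  · ring

theorem exists_sobolev_mulOp (hχ : ContDiff ℝ (⊤ : ℕ∞) (fun x : ℝ => χ (x : Torus))) {s : ℝ}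
    (hs : 0 ≤ s) : ∃ B : Sobolev s →L[ℂ] Sobolev s, ∀ u, (B u).toL2 = mulOp χ u.toL2 := by
  refine exists_sobolev_clm (hasSum_fourierCoeff_mulOp χ)
    ((summable_sobolevWeight_mul_fourierCoeff (isSmooth_toComplex hχ) s).mul_left
      (2 ^ (s / 2))) fun m n => ?_
  refine (mul_le_mul_of_nonneg_right (sobolevWeight_le_mul hs m n) (norm_nonneg _)).trans_eq ?_
  ring

/-- The gain of one derivative factors the remainder as a bounded operator followed by the diagonal
operator with entries `(1 + n²)^{-1/2}`, which tend to zero. -/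
theorem isCompactOperator_humRemainder (hT : 0 ≤ T)
    (hχ : ContDiff ℝ (⊤ : ℕ∞) (fun x : ℝ => χ (x : Torus))) :
    IsCompactOperator (humRemainder T χ) := by
  obtain ⟨A, hA⟩ := exists_clm_of_matrix
    (M := fun m n => (sobolevWeight 1 m : ℂ) * humMatrix T χ m n)
    ((summable_sobolevWeight_mul_fourierCoeff (isSmooth_toComplex_sq hχ) 1).mul_left (T + 2))
    fun m n => by
      rw [norm_mul, norm_sobolevWeight]
      exact sobolevWeight_one_mul_norm_humMatrix_le hT χ m n
  have hd : ∀ n : ℤ, ‖((sobolevWeight 1 n : ℂ))⁻¹‖ ≤ 1 := fun n => by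
    rw [norm_inv, norm_sobolevWeight]
    exact inv_le_one_of_one_le₀ (one_le_sobolevWeight zero_le_one n)
  have hlim : Filter.Tendsto (fun n : ℤ => ((sobolevWeight 1 n : ℂ))⁻¹) Filter.cofinite
      (nhds 0) := by
    rw [tendsto_zero_iff_norm_tendsto_zero]
    have h1 := (summable_inv_one_add_sq.tendsto_cofinite_zero).sqrt
    rw [Real.sqrt_zero] at h1
    refine h1.congr fun n => ?_
    rw [norm_inv, norm_sobolevWeight, ← sobolevWeight_one_sq, Real.sqrt_inv,
      Real.sqrt_sq (sobolevWeight_pos _ _).le]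
  have hcomp : humRemainder T χ = fun u => fourierIso.symm
      (weightedShift _ 1 hd (Equiv.refl ℤ) (A (fourierIso u))) := by
    funext u
    refine L2.ext_fourierCoeff fun m => ?_
    rw [← fourierIso_apply (fourierIso.symm _), LinearIsometryEquiv.apply_symm_apply,
      weightedShift_apply, Equiv.refl_apply]
    refine (hasSum_fourierCoeff_humRemainder T χ u m).unique ?_
    refine ((hA (fourierIso u) m).mul_left ((sobolevWeight 1 m : ℂ))⁻¹).congr_fun fun n => ?_
    rw [fourierIso_apply, mul_assoc, inv_mul_cancel_left₀ (sobolevWeight_ne_zero 1 m)]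
  rw [hcomp]
  have h1 := (isCompactOperator_weightedShift_refl hd hlim).comp_clm
    (A.comp (fourierIso.toContinuousLinearEquiv : L2 →L[ℂ] Seq))
  exact h1.clm_comp (fourierIso.symm.toContinuousLinearEquiv : Seq →L[ℂ] L2)

/-- Regularity: solutions `u ∈ L²` of `S u = f` are as smooth as `f`. -/
theorem mem_sobolevSubmodule_of_humCLM (hT : 0 < T) (h0 : meanSq χ ≠ 0)
    (hχ : ContDiff ℝ (⊤ : ℕ∞) (fun x : ℝ => χ (x : Torus))) {s : ℝ} {u : L2}
    (hu : humCLM T χ u ∈ sobolevSubmodule s) : u ∈ sobolevSubmodule s := by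
  have hc : (T : ℂ) * meanSq χ ≠ 0 := mul_ne_zero (by exact_mod_cast hT.ne') h0
  -- Bootstrap: each use of `u = (T c(0))⁻¹ (S u - R u)` gains one derivative, capped at the
  -- regularity `s` of `S u`.
  have hstep : ∀ k : ℕ, u ∈ sobolevSubmodule (min s k) := by
    intro k
    induction k with
    | zero =>
      refine sobolevSubmodule_anti (s := 0) (by simp) ?_
      rw [sobolevSubmodule_zero]
      trivial
    | succ k ih =>
      rcases le_total s k with h | h
      · rw [min_eq_left h] at ih
        exact sobolevSubmodule_anti (min_le_left _ _) ih
      · rw [min_eq_right h] at ih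
        obtain ⟨B, hB⟩ := exists_sobolev_humRemainder hT.le hχ (Nat.cast_nonneg (α := ℝ) k)
        have h1 : humRemainder T χ u ∈ sobolevSubmodule ((k : ℝ) + 1) := by
          have := (B (Sobolev.mk u ih)).toL2_mem
          rwa [hB] at this
        have h2 : u = ((T : ℂ) * meanSq χ)⁻¹ • (humCLM T χ u - humRemainder T χ u) := by
          rw [humRemainder_apply, sub_sub_cancel, inv_smul_smul₀ hc]
        rw [h2]
        refine Submodule.smul_mem _ _ (Submodule.sub_mem _ ?_ ?_)
        · exact sobolevSubmodule_anti (min_le_left _ _) hu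
        · exact sobolevSubmodule_anti ((min_le_right _ _).trans_eq (by push_cast; rfl)) h1
  obtain ⟨k, hk⟩ := exists_nat_ge s
  simpa [min_eq_left hk] using hstep k

end Smooth

/-! ### Unique continuation and invertibility of the HUM operator -/

theorem meanSq_ne_zero {ω : Set Torus} (hne : ω.Nonempty) {χ : C(Torus, ℝ)} {C : ℝ} (hC : 0 < C)
    (hpos : ∀ x ∈ ω, C < χ x) : meanSq χ ≠ 0 := by
  obtain ⟨x₀, hx₀⟩ := hne
  have h1 : meanSq χ = ((∫ x, χ x ^ 2 ∂torusMeasure : ℝ) : ℂ) := by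
    rw [meanSq, fourierCoeff, ← integral_complex_ofReal]
    refine integral_congr_ae (Filter.Eventually.of_forall fun x => ?_)
    simp [toComplex]
  have h2 : 0 < ∫ x, χ x ^ 2 ∂torusMeasure :=
    (χ.continuous.pow 2).integral_pos_of_hasCompactSupport_nonneg_nonzero
      (HasCompactSupport.of_compactSpace _) (fun x => sq_nonneg _)
      (pow_ne_zero 2 (hC.trans (hpos x₀ hx₀)).ne')
  rw [h1]
  exact_mod_cast h2.ne'

/-- Unitarity of the flow and self-adjointness of multiplication by `χ` give `⟨u, S u⟩ = ∫₀ᵀ ‖χ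
e^{it∂ₓ²}u‖² dt`; the integrand is continuous, so a zero integral forces it to vanish everywhere on
`[0,T]`. -/
theorem humOperator_eq_zero_iff {T : ℝ} (hT : 0 < T) (χ : C(Torus, ℝ)) (u : L2) :
    humOperator T χ u = 0 ↔ ∀ t ∈ Set.Icc 0 T, mulOp χ (schrodingerFlow t u) = 0 := by
  have hc : Continuous fun t => ‖mulOp χ (schrodingerFlow t u)‖ ^ 2 :=
    (continuous_mulOp χ (continuous_flow_apply u)).norm.pow 2
  constructor
  · intro h
    have h1 : ((∫ t in (0 : ℝ)..T, ‖mulOp χ (schrodingerFlow t u)‖ ^ 2 : ℝ) : ℂ) = 0 := by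
      rw [← intervalIntegral.integral_ofReal]
      have h2 := (innerSL ℂ u).intervalIntegral_comp_comm
        ((continuous_humIntegrand χ u).intervalIntegrable (μ := volume) 0 T)
      change _ = innerSL ℂ u (humOperator T χ u) at h2
      rw [h, map_zero] at h2
      rw [← h2]
      refine intervalIntegral.integral_congr fun t _ => ?_
      simp only [innerSL_apply_apply]
      rw [← inner_flow_left, ← mulOp_mulOp, ← inner_mulOp_left, inner_self_eq_norm_sq_to_K]
      simp
    by_contra! hcon
    obtain ⟨t, ht, hne⟩ := hcon
    have h3 := intervalIntegral.integral_pos hT hc.continuousOn (fun _ _ => sq_nonneg _)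
      ⟨t, ht, pow_pos (norm_pos_iff.mpr hne) 2⟩
    exact h3.ne' (by exact_mod_cast h1)
  · intro h
    have h1 : Set.EqOn (fun t => schrodingerFlow (-t) (mulOp (χ ^ 2) (schrodingerFlow t u)))
        (fun _ => 0) (Set.uIcc 0 T) := fun t ht => by
      rw [Set.uIcc_of_le hT.le] at ht
      simp only
      rw [← mulOp_mulOp, h t ht, ← flowLI_apply, ← mulCLM_apply, map_zero, map_zero]
    rw [humOperator, intervalIntegral.integral_congr h1, intervalIntegral.integral_zero]

/-- The kernel of the HUM operator is invariant under `∂ₓ²`. -/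
theorem exists_laplacian_of_humOperator_eq_zero {T : ℝ} (hT : 0 < T) {χ : C(Torus, ℝ)}
    (h0 : meanSq χ ≠ 0) (hχ : ContDiff ℝ (⊤ : ℕ∞) (fun x : ℝ => χ (x : Torus))) {u : L2}
    (hu : humOperator T χ u = 0) :
    ∃ v : L2, humOperator T χ v = 0 ∧ ∀ n, fourierCoeff (v : Torus → ℂ) n =
      -(4 * Real.pi ^ 2 * (n : ℝ) ^ 2 : ℝ) * fourierCoeff (u : Torus → ℂ) n := by
  have hreg : u ∈ sobolevSubmodule 2 := mem_sobolevSubmodule_of_humCLM hT h0 hχ (by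
    rw [humCLM_apply, hu]
    exact Submodule.zero_mem _)
  have hmem : Memℓp (fun n : ℤ => (-(4 * Real.pi ^ 2 * (n : ℝ) ^ 2 : ℝ) : ℂ) *
      fourierCoeff (u : Torus → ℂ) n) 2 := by
    have h1 : Memℓp (((4 * Real.pi ^ 2 : ℝ) : ℂ) • sobolevCoeff 2 u) 2 := hreg.const_smul _
    refine h1.mono' fun n => ?_
    rw [Pi.smul_apply, sobolevCoeff, smul_eq_mul, norm_mul, norm_mul, norm_mul,
      norm_sobolevWeight, sobolevWeight_two, norm_neg, Complex.norm_real, Complex.norm_real,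
      Real.norm_of_nonneg (by positivity), Real.norm_of_nonneg (by positivity), ← mul_assoc]
    gcongr
    linarith
  let v : L2 := fourierIso.symm ⟨_, hmem⟩
  have hv : ∀ n, fourierCoeff (v : Torus → ℂ) n =
      -(4 * Real.pi ^ 2 * (n : ℝ) ^ 2 : ℝ) * fourierCoeff (u : Torus → ℂ) n := fun n => by
    rw [← fourierIso_apply, LinearIsometryEquiv.apply_symm_apply]
  refine ⟨v, ?_, hv⟩
  rw [humOperator_eq_zero_iff hT] at hu ⊢
  intro t ht
  -- The identity `χ e^{it∂ₓ²}u = 0` is differentiated in time. Derivatives within `[0,T]` are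
  -- unique, end points included, so `χ e^{it∂ₓ²}v = 0` on all of `[0,T]` and no time is lost.
  have h1 : HasDerivWithinAt (fun t => mulCLM χ (schrodingerFlow t u))
      (mulCLM χ (schrodingerFlow t (Complex.I • v))) (Set.Icc 0 T) t :=
    ((mulCLM χ).restrictScalars ℝ).hasFDerivAt.comp_hasDerivWithinAt t
      (hasDerivAt_flow hv t).hasDerivWithinAt
  have h2 : HasDerivWithinAt (fun t => mulCLM χ (schrodingerFlow t u)) 0 (Set.Icc 0 T) t :=
    (hasDerivWithinAt_const t _ (0 : L2)).congr (fun τ hτ => hu τ hτ) (hu t ht)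
  have h3 := (uniqueDiffOn_Icc hT t ht).eq_deriv _ h1 h2
  rw [← flowLI_apply, map_smul, map_smul, flowLI_apply, mulCLM_apply] at h3
  exact (smul_eq_zero.mp h3).resolve_left Complex.I_ne_zero

/-- An eigenfunction of `∂ₓ²` vanishing on a non-empty open set is zero. -/
theorem fourierCoeff_eq_zero_of_eigenfunction {ω : Set Torus} (hω : IsOpen ω) (hne : ω.Nonempty)
    {χ : C(Torus, ℝ)} {C : ℝ} (hC : 0 < C) (hpos : ∀ x ∈ ω, C < χ x) {u : L2}
    (hu : mulOp χ u = 0) {k : ℤ}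
    (hk : ∀ n, fourierCoeff (u : Torus → ℂ) n ≠ 0 → n ^ 2 = k ^ 2) :
    fourierCoeff (u : Torus → ℂ) k = 0 := by
  set a := fourierCoeff (u : Torus → ℂ) k with ha
  -- For `k = 0` the two exponentials coincide, and the coefficient must not be counted twice.
  let b : ℂ := if k = 0 then 0 else fourierCoeff (u : Torus → ℂ) (-k)
  let p : C(Torus, ℂ) := a • fourier k + b • fourier (-k)
  have hp : u = ContinuousMap.toLp 2 torusMeasure ℂ p := by
    refine L2.ext_fourierCoeff fun n => ?_
    rw [← coeffCLM_apply n (ContinuousMap.toLp 2 torusMeasure ℂ p), map_add, map_smul, map_smul,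
      map_add, map_smul, map_smul, coeffCLM_apply, coeffCLM_apply, fourierCoeff_toLp,
      fourierCoeff_toLp, fourierCoeff_fourier, fourierCoeff_fourier, smul_eq_mul, smul_eq_mul]
    by_cases h1 : n = k
    · subst h1
      by_cases h2 : n = 0
      · simp [b, h2, ha]
      · have h3 : n ≠ -n := by omega
        simp [h3, ha]
    · by_cases h2 : n = -k
      · have h3 : k ≠ 0 := by
          rintro rfl
          simp at h2
          exact h1 h2
        simp [Pi.single_apply, h2, b, h3]
        omega
      · have h3 : fourierCoeff (u : Torus → ℂ) n = 0 := by
          by_contra h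
          rcases sq_eq_sq_iff_eq_or_eq_neg.mp (hk n h) with h | h
          exacts [h1 h, h2 h]
        rw [h3, Pi.single_apply, Pi.single_apply, if_neg h1, if_neg h2]
        ring
  have hae : (p : Torus → ℂ) =ᵐ[torusMeasure.restrict ω] fun _ => 0 := by
    have h1 : (u : Torus → ℂ) =ᵐ[torusMeasure] p := by
      rw [hp]
      exact ContinuousMap.coeFn_toLp _ _
    have h2 : (mulOp χ u : Torus → ℂ) =ᵐ[torusMeasure] 0 := by
      rw [hu]
      exact Lp.coeFn_zero _ _ _
    rw [Filter.EventuallyEq, ae_restrict_iff' hω.measurableSet]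
    filter_upwards [h1, h2, coe_mulOp χ u] with x h1 h2 h3 hx
    rw [← h1]
    rw [h2] at h3
    have h4 : (χ x : ℂ) ≠ 0 := by exact_mod_cast (hC.trans (hpos x hx)).ne'
    simpa [h4] using h3.symm
  have hzero := Measure.eqOn_open_of_ae_eq hae hω p.continuous.continuousOn continuousOn_const
  obtain ⟨x₀, hx₀⟩ := hne
  induction x₀ using QuotientAddGroup.induction_on with | H y => ?_
  change (y : Torus) ∈ ω at hx₀
  have hval : a * fourier k (y : Torus) + b * fourier (-k) (y : Torus) = 0 := hzero hx₀
  have hne0 : ∀ n, fourier n (y : Torus) ≠ 0 := fun n => by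
    rw [fourier_coe_apply]
    exact Complex.exp_ne_zero _
  by_cases hk0 : k = 0
  · simp only [b, hk0, if_true, zero_mul, add_zero] at hval
    exact (mul_eq_zero.mp hval).resolve_right (hne0 0)
  -- At a point of `ω` both the function and its derivative vanish. For `k ≠ 0` this says that the
  -- sum and the difference of the two terms are zero.
  · have hnear : (fun z : ℝ => a * fourier k (z : Torus) + b * fourier (-k) (z : Torus))
        =ᶠ[nhds y] fun _ => 0 :=
      Filter.mem_of_superset ((hω.preimage (AddCircle.continuous_mk' 1)).mem_nhds hx₀)
        fun z hz => hzero hz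
    have hd := ((hasDerivAt_fourier 1 k y).const_mul a).add
      ((hasDerivAt_fourier_neg 1 k y).const_mul b)
    have hd0 := hd.unique ((hasDerivAt_const y (0 : ℂ)).congr_of_eventuallyEq hnear)
    have hk' : (k : ℂ) ≠ 0 := by exact_mod_cast hk0
    have h1 : (2 * Real.pi * Complex.I * k : ℂ) *
        (a * fourier k (y : Torus) - b * fourier (-k) (y : Torus)) = 0 := by
      rw [← hd0]
      push_cast
      ring
    have h2 : (2 * Real.pi * Complex.I * k : ℂ) ≠ 0 := by
      simp [hk', Real.pi_ne_zero]
    have h3 := (mul_eq_zero.mp h1).resolve_left h2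
    have h4 : a * fourier k (y : Torus) = 0 := by linear_combination (hval + h3) / 2
    exact (mul_eq_zero.mp h4).resolve_right (hne0 k)

/-- The kernel lies in an eigenspace of the compact remainder for a non-zero eigenvalue, so it is
finite dimensional. Being stable under `∂ₓ²`, it would contain an eigenfunction of `∂ₓ²` if it were
non-zero. -/
theorem ker_humCLM {T : ℝ} (hT : 0 < T) {ω : Set Torus} (hω : IsOpen ω) (hne : ω.Nonempty)
    {χ : C(Torus, ℝ)} (hχ : ContDiff ℝ (⊤ : ℕ∞) (fun x : ℝ => χ (x : Torus))) {C : ℝ} (hC : 0 < C)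
    (hpos : ∀ x ∈ ω, C < χ x) :
    LinearMap.ker (humCLM T χ : L2 →ₗ[ℂ] L2) = ⊥ := by
  set N := LinearMap.ker (humCLM T χ : L2 →ₗ[ℂ] L2) with hN
  have h0 := meanSq_ne_zero hne hC hpos
  have hmem : ∀ u, u ∈ N ↔ humOperator T χ u = 0 := fun u => Iff.rfl
  have hfin : FiniteDimensional ℂ N := by
    have h1 := ContinuousLinearMap.finite_dimensional_eigenspace
      (isCompactOperator_humRemainder hT.le hχ) (-(T * meanSq χ))
      (neg_ne_zero.mpr (mul_ne_zero (by exact_mod_cast hT.ne') h0))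
    have h2 : N ≤ Module.End.eigenspace (humRemainder T χ : L2 →ₗ[ℂ] L2) (-(T * meanSq χ)) := by
      intro u hu
      rw [Module.End.mem_eigenspace_iff]
      change humRemainder T χ u = _
      rw [humRemainder_apply, humCLM_apply, (hmem u).mp hu, zero_sub, neg_smul]
    exact Submodule.finiteDimensional_of_le h2
  by_contra hbot
  have : Nontrivial N := Submodule.nontrivial_iff_ne_bot.mpr hbot
  -- The chosen `v` is linear on the kernel because its Fourier coefficients are prescribed.
  choose! v hv0 hv using fun u : L2 =>
    exists_laplacian_of_humOperator_eq_zero (u := u) hT h0 hχ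
  let D : Module.End ℂ N :=
    { toFun := fun u => ⟨v u, (hmem _).mpr (hv0 u u.2)⟩
      map_add' := fun x y => Subtype.ext <| L2.ext_fourierCoeff fun n => by
        change fourierCoeff (v ((x : L2) + y) : Torus → ℂ) n =
          fourierCoeff ((v x + v y : L2) : Torus → ℂ) n
        rw [hv _ ((hmem _).mp (N.add_mem x.2 y.2)), fourierCoeff_add, fourierCoeff_add,
          hv _ x.2, hv _ y.2]
        ring
      map_smul' := fun c x => Subtype.ext <| L2.ext_fourierCoeff fun n => by
        change fourierCoeff (v (c • (x : L2)) : Torus → ℂ) n =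
          fourierCoeff ((c • v x : L2) : Torus → ℂ) n
        rw [hv _ ((hmem _).mp (N.smul_mem c x.2)), fourierCoeff_smul, fourierCoeff_smul,
          hv _ x.2]
        ring }
  obtain ⟨μ, hμ⟩ := Module.End.exists_eigenvalue D
  obtain ⟨⟨u, huN⟩, hu⟩ := hμ.exists_hasEigenvector
  have hu0 : u ≠ 0 := fun h => hu.2 (Subtype.ext h)
  have heq : v u = μ • u := congrArg Subtype.val hu.apply_eq_smul
  have hcoef : ∀ n, fourierCoeff (u : Torus → ℂ) n ≠ 0 →
      -((4 * Real.pi ^ 2 * (n : ℝ) ^ 2 : ℝ) : ℂ) = μ := fun n hn => by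
    have h1 := hv u huN n
    rw [heq, fourierCoeff_smul] at h1
    exact (mul_right_cancel₀ hn h1).symm
  have hex : ∃ k, fourierCoeff (u : Torus → ℂ) k ≠ 0 := by
    by_contra! h
    refine hu0 (L2.ext_fourierCoeff fun n => ?_)
    rw [h n, ← coeffCLM_apply, map_zero]
  obtain ⟨k, hk⟩ := hex
  refine hk (fourierCoeff_eq_zero_of_eigenfunction hω hne hC hpos ?_ fun n hn => ?_)
  · have h1 := (humOperator_eq_zero_iff hT χ u).mp huN 0 ⟨le_rfl, hT.le⟩
    rwa [flow_zero] at h1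
  · have h1 := (hcoef n hn).trans (hcoef k hk).symm
    have h2 : 4 * Real.pi ^ 2 * (n : ℝ) ^ 2 = 4 * Real.pi ^ 2 * (k : ℝ) ^ 2 := by
      exact_mod_cast neg_injective h1
    have h3 := mul_left_cancel₀ (by positivity) h2
    exact_mod_cast h3

/-- Fredholm alternative for the compact remainder at `λ = -T c(0)`: an eigenvector would lie in the
kernel of `S`, so `λ - R = -S` is invertible. -/
theorem humCLM_bijective {T : ℝ} (hT : 0 < T) {ω : Set Torus} (hω : IsOpen ω) (hne : ω.Nonempty)
    {χ : C(Torus, ℝ)} (hχ : ContDiff ℝ (⊤ : ℕ∞) (fun x : ℝ => χ (x : Torus))) {C : ℝ} (hC : 0 < C)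
    (hpos : ∀ x ∈ ω, C < χ x) :
    Function.Bijective (humCLM T χ) := by
  have h0 := meanSq_ne_zero hne hC hpos
  have hker := ker_humCLM hT hω hne hχ hC hpos
  refine ⟨LinearMap.ker_eq_bot.mp hker, ?_⟩
  have hc : -((T : ℂ) * meanSq χ) ≠ 0 :=
    neg_ne_zero.mpr (mul_ne_zero (by exact_mod_cast hT.ne') h0)
  rcases (isCompactOperator_humRemainder hT.le hχ).hasEigenvalue_or_mem_resolventSet hc with h | h
  · obtain ⟨u, hu⟩ := h.exists_hasEigenvector
    refine (hu.2 ?_).elim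
    have h1 : humRemainder T χ u = -((T : ℂ) * meanSq χ) • u := hu.apply_eq_smul
    rw [humRemainder_apply, neg_smul, sub_eq_add_neg, add_eq_right] at h1
    have h2 : u ∈ LinearMap.ker (humCLM T χ : L2 →ₗ[ℂ] L2) := h1
    rwa [hker] at h2
  · rw [spectrum.mem_resolventSet_iff, ← IsUnit.neg_iff,
      ContinuousLinearMap.isUnit_iff_bijective] at h
    convert h.2 using 1
    funext u
    simp [humRemainder, Algebra.algebraMap_eq_smul_one]

/-- The HUM operator is an isomorphism of `H^s`. -/
theorem exists_sobolev_humEquiv {T : ℝ} (hT : 0 < T) {ω : Set Torus} (hω : IsOpen ω) (hne : ω.Nonempty)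
    {χ : C(Torus, ℝ)} (hχ : ContDiff ℝ (⊤ : ℕ∞) (fun x : ℝ => χ (x : Torus))) {C : ℝ} (hC : 0 < C)
    (hpos : ∀ x ∈ ω, C < χ x)
    {s : ℝ} (hs : 0 ≤ s) :
    ∃ e : Sobolev s ≃L[ℂ] Sobolev s, ∀ u, (e u).toL2 = humOperator T χ u.toL2 := by
  have h0 := meanSq_ne_zero hne hC hpos
  have hbij := humCLM_bijective hT hω hne hχ hC hpos
  have hsum := fun (u : L2) (m : ℤ) => hasSum_fourierCoeff_clm (humCLM T χ) u m
  obtain ⟨B, hB⟩ := exists_sobolev_clm (r := s) (s := s) hsum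
    ((summable_sobolevWeight_mul_fourierCoeff (isSmooth_toComplex_sq hχ) s).mul_left
      (2 ^ (s / 2) * T)) fun m n => by
    rw [fourierCoeff_humCLM_expL2, norm_mul]
    have h1 := sobolevWeight_le_mul hs m n
    have h2 := norm_oscIntegral_le hT.le (m ^ 2 - n ^ 2)
    have h3 := sobolevWeight_pos s n
    have h4 := sobolevWeight_pos s (m - n)
    calc _ ≤ (2 ^ (s / 2) * sobolevWeight s (m - n) * sobolevWeight s n) *
          (‖fourierCoeff (toComplex (χ ^ 2)) (m - n)‖ * T) := by gcongr
      _ = _ := by ring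
  -- Completeness is what the open mapping theorem needs to make the inverse continuous.
  have := Sobolev.completeSpace hs
  have hinj : Function.Injective B := fun u v h => Sobolev.toL2_injective <| hbij.1 <| by
    rw [← hB, ← hB, h]
  have hsurj : Function.Surjective B := fun w => by
    obtain ⟨u, hu⟩ := hbij.2 w.toL2
    have hmem : u ∈ sobolevSubmodule s := mem_sobolevSubmodule_of_humCLM hT h0 hχ (by
      rw [hu]
      exact w.toL2_mem)
    refine ⟨Sobolev.mk u hmem, Sobolev.toL2_injective ?_⟩
    rw [hB, Sobolev.toL2_mk, hu]
  exact ⟨ContinuousLinearEquiv.ofBijective B (LinearMap.ker_eq_bot.mpr hinj)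
    (LinearMap.range_eq_top.mpr hsurj), hB⟩

/-! ### Weak solutions and Duhamel's formula -/

theorem fourierCoeff_sub_smul (u v : L2) (c : ℂ) (n : ℤ) :
    fourierCoeff ((u - c • v : L2) : Torus → ℂ) n =
      fourierCoeff (u : Torus → ℂ) n - c * fourierCoeff (v : Torus → ℂ) n := by
  rw [sub_eq_add_neg, ← neg_smul, fourierCoeff_add, fourierCoeff_smul]
  ring

/-- Duhamel's formula for the solution of `i ∂ₜ u + ∂ₓ² u = f`, `u(0) = u₀`. -/
def duhamel (f : ℝ → L2) (u₀ : L2) (t : ℝ) : L2 :=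
  schrodingerFlow t (u₀ - Complex.I • ∫ τ in (0 : ℝ)..t, schrodingerFlow (-τ) (f τ))

theorem duhamel_zero (f : ℝ → L2) (u₀ : L2) : duhamel f u₀ 0 = u₀ := by
  rw [duhamel, intervalIntegral.integral_same, smul_zero, sub_zero, flow_zero]

theorem hasDerivAt_duhamel_integral {f : ℝ → L2} (hf : Continuous f) (u₀ : L2) (t : ℝ) :
    HasDerivAt (fun t => u₀ - Complex.I • ∫ τ in (0 : ℝ)..t, schrodingerFlow (-τ) (f τ))
      (-(Complex.I • schrodingerFlow (-t) (f t))) t :=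
  (((continuous_flow continuous_neg hf).integral_hasStrictDerivAt 0 t).hasDerivAt.const_smul
    Complex.I).const_sub u₀

/-- The pairing with `φ` equals the inner product of `e^{-it∂ₓ²}` applied to the conjugate of `φ`
with `e^{-it∂ₓ²}u(t)`. Both factors are differentiable in `L²` even though `u` need not be. -/
theorem isSchrodingerSolution_duhamel (T : ℝ) {f : ℝ → L2} (hf : Continuous f) (u₀ : L2) :
    IsSchrodingerSolution T f (duhamel f u₀) := by
  have hw := hasDerivAt_duhamel_integral hf u₀
  refine ⟨(continuous_flow continuous_id (continuous_iff_continuousAt.mpr fun t =>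
    (hw t).continuousAt)).continuousOn, fun φ hφ t _ => ?_⟩
  have hφ' : IsSmooth φ := hφ
  let φ₀ : C(Torus, ℂ) := ⟨φ, hφ'.continuous⟩
  let φ₂ : C(Torus, ℂ) := ⟨secondDeriv φ, hφ'.secondDeriv.continuous⟩
  have hcoef : ∀ n, fourierCoeff (conjL2 φ₂ : Torus → ℂ) n =
      -(4 * Real.pi ^ 2 * (n : ℝ) ^ 2 : ℝ) * fourierCoeff (conjL2 φ₀ : Torus → ℂ) n := fun n => by
    rw [fourierCoeff_conjL2, fourierCoeff_conjL2]
    change starRingEnd ℂ (fourierCoeff (secondDeriv φ) (-n)) = _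
    rw [fourierCoeff_secondDeriv hφ', map_mul, map_neg, Complex.conj_ofReal]
    push_cast
    rw [neg_sq]
    rfl
  have h1 : HasDerivAt (fun t => schrodingerFlow (-t) (conjL2 φ₀))
      (-schrodingerFlow (-t) (Complex.I • conjL2 φ₂)) t := by
    have := (hasDerivAt_flow hcoef (-t)).scomp t (hasDerivAt_neg t)
    rw [neg_one_smul] at this
    exact this
  have h2 := h1.inner ℂ (hw t)
  have h3 : ∀ τ, inner ℂ (schrodingerFlow (-τ) (conjL2 φ₀))
      (u₀ - Complex.I • ∫ σ in (0 : ℝ)..τ, schrodingerFlow (-σ) (f σ)) =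
      ∫ x, duhamel f u₀ τ x * φ x ∂torusMeasure := fun τ => by
    rw [inner_flow_left, neg_neg]
    exact inner_conjL2 φ₀ _
  simp only [h3] at h2
  refine ⟨_, h2.hasDerivWithinAt, ?_⟩
  have h4 : inner ℂ (schrodingerFlow (-t) (conjL2 φ₀)) (-(Complex.I • schrodingerFlow (-t) (f t)))
      = -(Complex.I * ∫ x, f t x * φ x ∂torusMeasure) := by
    rw [inner_neg_right, inner_smul_right, inner_flow_left, flow_flow, neg_neg, add_neg_cancel,
      flow_zero, inner_conjL2]
    rfl
  have h5 : inner ℂ (-schrodingerFlow (-t) (Complex.I • conjL2 φ₂))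
      (u₀ - Complex.I • ∫ σ in (0 : ℝ)..t, schrodingerFlow (-σ) (f σ)) =
      Complex.I * ∫ x, duhamel f u₀ t x * secondDeriv φ x ∂torusMeasure := by
    rw [inner_neg_left, inner_flow_left, neg_neg, inner_smul_left, Complex.conj_I, neg_mul,
      neg_neg, inner_conjL2]
    rfl
  rw [h4, h5]
  linear_combination (∫ x, duhamel f u₀ t x * secondDeriv φ x ∂torusMeasure -
    ∫ x, f t x * φ x ∂torusMeasure) * Complex.I_sq

/-! ### Uniqueness of weak solutions -/

theorem isSmooth_fourier (n : ℤ) : IsSmooth (fourier n : C(Torus, ℂ)) := by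
  unfold IsSmooth
  simp only [fourier_coe_apply]
  exact ((contDiff_const.mul Complex.ofRealCLM.contDiff).div_const _).cexp

theorem secondDeriv_fourier_neg (n : ℤ) (x : Torus) :
    secondDeriv (fourier (-n) : C(Torus, ℂ)) x =
      -(4 * Real.pi ^ 2 * (n : ℝ) ^ 2 : ℝ) * fourier (-n) x := by
  have h1 : ∀ y : Torus, torusDeriv (fourier (-n) : C(Torus, ℂ)) y =
      -2 * Real.pi * Complex.I * n * fourier (-n) y := fun y => by
    induction y using QuotientAddGroup.induction_on with | H y => ?_
    rw [torusDeriv_coe]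
    simpa using (hasDerivAt_fourier_neg 1 n y).deriv
  rw [secondDeriv_eq, funext h1]
  induction x using QuotientAddGroup.induction_on with | H x => ?_
  rw [torusDeriv_coe]
  rw [((hasDerivAt_fourier_neg 1 n x).const_mul (-2 * Real.pi * Complex.I * n : ℂ)).deriv]
  push_cast
  linear_combination 4 * Real.pi ^ 2 * n ^ 2 * fourier (-n) (x : Torus) * Complex.I_sq

/-- Every weak solution is given by Duhamel's formula. -/
theorem IsSchrodingerSolution.eq_duhamel {T : ℝ} {f u : ℝ → L2} (hf : Continuous f)
    (h : IsSchrodingerSolution T f u) {t : ℝ} (ht : t ∈ Set.Icc 0 T) :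
    u t = duhamel f (u 0) t := by
  refine L2.ext_fourierCoeff fun n => ?_
  have hcoef : ∀ v : L2, ∫ x, v x * fourier (-n) x ∂torusMeasure =
      fourierCoeff (v : Torus → ℂ) n := fun v => by
    simp only [fourierCoeff, smul_eq_mul, mul_comm]
  have hder : ∀ τ ∈ Set.Icc 0 T, HasDerivWithinAt (fun τ => fourierCoeff (u τ : Torus → ℂ) n)
      (-Complex.I * (fourierCoeff (f τ : Torus → ℂ) n +
        (4 * Real.pi ^ 2 * (n : ℝ) ^ 2 : ℝ) * fourierCoeff (u τ : Torus → ℂ) n))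
      (Set.Icc 0 T) τ := fun τ hτ => by
    obtain ⟨d, hd, heq⟩ := h.2 _ (isSmooth_fourier (-n)) τ hτ
    simp only [secondDeriv_fourier_neg, mul_left_comm _ (-(_ : ℂ)), integral_const_mul, hcoef]
      at hd heq
    refine hd.congr_deriv ?_
    linear_combination (-Complex.I) * heq + d * Complex.I_sq
  have hphase : ∀ τ : ℝ, HasDerivAt (fun τ => phase (-τ) n)
      ((4 * Real.pi ^ 2 * (n : ℝ) ^ 2 : ℝ) * Complex.I * phase (-τ) n) τ := fun τ => by
    have := (hasDerivAt_phase n (-τ)).scomp τ (hasDerivAt_neg τ)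
    refine this.congr_deriv ?_
    simp
  -- Testing with an exponential gives a scalar linear equation for each Fourier coefficient; `phase
  -- (-τ) n` is its integrating factor.
  have hy : ∀ τ ∈ Set.Icc 0 T, HasDerivWithinAt
      (fun τ => phase (-τ) n * fourierCoeff (u τ : Torus → ℂ) n)
      (-Complex.I * (phase (-τ) n * fourierCoeff (f τ : Torus → ℂ) n)) (Set.Icc 0 T) τ :=
    fun τ hτ => ((hphase τ).hasDerivWithinAt.mul (hder τ hτ)).congr_deriv (by ring)
  have hcf : Continuous fun τ => fourierCoeff (f τ : Torus → ℂ) n := by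
    simp only [← coeffCLM_apply]
    exact (coeffCLM n).continuous.comp hf
  have hint := intervalIntegral.integral_eq_sub_of_hasDerivAt_of_le ht.1
    (fun τ hτ => ((hy τ ⟨hτ.1, hτ.2.trans ht.2⟩).mono
      (Set.Icc_subset_Icc_right ht.2)).continuousWithinAt)
    (fun τ hτ => (hy τ ⟨hτ.1.le, hτ.2.le.trans ht.2⟩).hasDerivAt
      (Icc_mem_nhds hτ.1 (hτ.2.trans_le ht.2)))
    ((continuous_const.mul (((continuous_phase n).comp continuous_neg).mul
      hcf)).intervalIntegrable _ _)
  rw [duhamel, fourierCoeff_flow, fourierCoeff_sub_smul, ← coeffCLM_apply n (∫ τ in (0 : ℝ)..t, _),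
    ← (coeffCLM n).intervalIntegral_comp_comm
      ((continuous_flow continuous_neg hf).intervalIntegrable _ _)]
  simp only [coeffCLM_apply, fourierCoeff_flow]
  rw [intervalIntegral.integral_const_mul, neg_zero, phase_zero, one_mul] at hint
  linear_combination (-phase t n) * hint -
    fourierCoeff (u t : Torus → ℂ) n * phase_neg_mul_phase t n

theorem IsSchrodingerSolution.congr {T : ℝ} {f g u : ℝ → L2} (h : IsSchrodingerSolution T f u)
    (hfg : ∀ t ∈ Set.Icc 0 T, f t = g t) : IsSchrodingerSolution T g u := by
  refine ⟨h.1, fun φ hφ t ht => ?_⟩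
  rw [← hfg t ht]
  exact h.2 φ hφ t ht

/-! ### Duhamel's formula and the HUM operator -/

theorem duhamel_const_zero (u₀ : L2) :
    duhamel (fun _ => 0) u₀ = fun t => schrodingerFlow t u₀ := by
  funext t
  have h : ∀ τ, schrodingerFlow (-τ) (0 : L2) = 0 := fun τ => map_zero (flowLI (-τ))
  simp only [duhamel, h, intervalIntegral.integral_zero, smul_zero, sub_zero]

theorem duhamel_humOperator (T : ℝ) (χ : C(Torus, ℝ)) (Φ₀ u₀ : L2) :
    duhamel (fun t => mulOp (χ ^ 2) (schrodingerFlow t Φ₀)) u₀ T =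
      schrodingerFlow T (u₀ - Complex.I • humOperator T χ Φ₀) := rfl

theorem continuous_mulOp_flow (χ : C(Torus, ℝ)) (Φ₀ : L2) :
    Continuous fun t => mulOp χ (schrodingerFlow t Φ₀) :=
  continuous_mulOp χ (continuous_flow_apply Φ₀)

/-- The backward problem is solved forward from `Ψ(0) = i S Φ₀`, the value for which Duhamel's
formula vanishes at time `T`. -/
theorem exists_isHUMPair (T : ℝ) (χ : C(Torus, ℝ)) (Φ₀ : L2) :
    ∃ Ψ : ℝ → L2, IsHUMPair T χ Φ₀ (fun t => schrodingerFlow t Φ₀) Ψ := by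
  refine ⟨duhamel (fun t => mulOp (χ ^ 2) (schrodingerFlow t Φ₀))
    (Complex.I • humOperator T χ Φ₀), ?_, flow_zero Φ₀,
    isSchrodingerSolution_duhamel T (continuous_mulOp_flow _ Φ₀) _, ?_⟩
  · rw [← duhamel_const_zero]
    exact isSchrodingerSolution_duhamel T continuous_const Φ₀
  · rw [duhamel_humOperator, sub_self]
    exact map_zero (flowLI T)

theorem IsHUMPair.humOperator_eq {T : ℝ} (hT : 0 ≤ T) {χ : C(Torus, ℝ)} {Φ₀ : L2} {Φ Ψ : ℝ → L2}
    (h : IsHUMPair T χ Φ₀ Φ Ψ) : humOperator T χ Φ₀ = -Complex.I • Ψ 0 := by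
  obtain ⟨hΦ, h0, hΨ, hΨT⟩ := h
  have h1 : ∀ t ∈ Set.Icc 0 T, Φ t = schrodingerFlow t Φ₀ := fun t ht => by
    rw [hΦ.eq_duhamel continuous_const ht, duhamel_const_zero, h0]
  have h2 : IsSchrodingerSolution T (fun t => mulOp (χ ^ 2) (schrodingerFlow t Φ₀)) Ψ :=
    hΨ.congr fun t ht => by rw [h1 t ht]
  have h3 := h2.eq_duhamel (continuous_mulOp_flow _ Φ₀) (Set.right_mem_Icc.mpr hT)
  rw [hΨT, duhamel_humOperator, eq_comm, ← flowLI_apply,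
    map_eq_zero_iff _ (flowLI T).injective, sub_eq_zero] at h3
  rw [h3, smul_smul, neg_mul, Complex.I_mul_I, neg_neg, one_smul]

end HUM

end

/-! ### The main theorem -/

theorem theorem3p3 (T : ℝ) (hT : 0 < T)
    (ω : Set HUM.Torus) (hω : IsOpen ω) (hne : ω.Nonempty)
    (χ : C(HUM.Torus, ℝ)) (hχ : ContDiff ℝ (⊤ : ℕ∞) (fun x : ℝ => χ (x : HUM.Torus)))
    (C : ℝ) (hC : 0 < C) (hpos : ∀ x ∈ ω, C < χ x) :
    -- `S Φ₀ = -i Ψ(0)` for the pair of Cauchy problems defining `Φ` and `Ψ`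
    (∀ Φ₀ : HUM.L2,
      (∃ Ψ : ℝ → HUM.L2, HUM.IsHUMPair T χ Φ₀ (fun t => HUM.schrodingerFlow t Φ₀) Ψ) ∧
      ∀ Φ Ψ : ℝ → HUM.L2, HUM.IsHUMPair T χ Φ₀ Φ Ψ →
        HUM.humOperator T χ Φ₀ = -Complex.I • Ψ 0) ∧
    ∀ s : ℝ, 0 ≤ s →
      -- `S` is an isomorphism of `H^s`
      (∃ e : HUM.Sobolev s ≃L[ℂ] HUM.Sobolev s, ∀ u : HUM.Sobolev s,
        (e u).toL2 = HUM.humOperator T χ u.toL2) ∧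
      -- the HUM control `g = χ Φ` of an initial state in `H^s` is continuous with values in `H^s`
      ∃ K : ℝ, ∀ (u₀ : HUM.Sobolev s) (Φ₀ : HUM.L2),
        HUM.humOperator T χ Φ₀ = -Complex.I • u₀.toL2 →
        ∃ g : ℝ → HUM.Sobolev s, Continuous g ∧
          (∀ t, (g t).toL2 = HUM.mulOp χ (HUM.schrodingerFlow t Φ₀)) ∧
          (∀ t, ‖g t‖ ≤ K * ‖u₀‖) ∧
          (∃ u : ℝ → HUM.L2,
            HUM.IsSchrodingerSolution T (fun t => HUM.mulOp χ (g t).toL2) u ∧ u 0 = u₀.toL2) ∧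
          ∀ u : ℝ → HUM.L2,
            HUM.IsSchrodingerSolution T (fun t => HUM.mulOp χ (g t).toL2) u →
            u 0 = u₀.toL2 → u T = 0 := by
  refine ⟨fun Φ₀ => ⟨HUM.exists_isHUMPair T χ Φ₀, fun Φ Ψ h => h.humOperator_eq hT.le⟩,
    fun s hs => ?_⟩
  obtain ⟨e, he⟩ := HUM.exists_sobolev_humEquiv hT hω hne hχ hC hpos hs
  obtain ⟨B, hB⟩ := HUM.exists_sobolev_mulOp hχ hs
  refine ⟨⟨e, he⟩, ‖B‖ * ‖(e.symm : HUM.Sobolev s →L[ℂ] HUM.Sobolev s)‖, fun u₀ Φ₀ hΦ₀ => ?_⟩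
  -- `Φ₀` is only assumed to be in `L²`; injectivity of `S` on `L²` identifies it with the `H^s`
  -- preimage, which bounds it by `u₀`.
  have hv : (e.symm (-Complex.I • u₀)).toL2 = Φ₀ := by
    refine (HUM.humCLM_bijective hT hω hne hχ hC hpos).1 ?_
    rw [HUM.humCLM_apply, HUM.humCLM_apply, hΦ₀, ← he, e.apply_symm_apply, map_smul]
  obtain ⟨w, hwc, hw, hwn⟩ := HUM.exists_sobolev_flow hs (e.symm (-Complex.I • u₀))
  rw [hv] at hw
  have hg : ∀ t, (B (w t)).toL2 = HUM.mulOp χ (HUM.schrodingerFlow t Φ₀) := fun t => by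
    rw [hB, hw]
  have hf : (fun t => HUM.mulOp χ (B (w t)).toL2) =
      fun t => HUM.mulOp (χ ^ 2) (HUM.schrodingerFlow t Φ₀) := by
    funext t
    rw [hg, HUM.mulOp_mulOp]
  refine ⟨fun t => B (w t), B.continuous.comp hwc, hg, fun t => ?_, ?_, fun u hu hu0 => ?_⟩
  · rw [mul_assoc]
    refine (B.le_opNorm _).trans (mul_le_mul_of_nonneg_left ((hwn t).trans ?_) (norm_nonneg _))
    refine ((e.symm : HUM.Sobolev s →L[ℂ] HUM.Sobolev s).le_opNorm _).trans_eq ?_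
    rw [norm_smul, norm_neg, Complex.norm_I, one_mul]
  · rw [hf]
    exact ⟨_, HUM.isSchrodingerSolution_duhamel T (HUM.continuous_mulOp_flow _ Φ₀) u₀.toL2,
      HUM.duhamel_zero _ _⟩
  · rw [hf] at hu
    -- The final state is `e^{iT∂ₓ²}(u₀ - i S Φ₀)`, and `i S Φ₀ = u₀`.
    rw [hu.eq_duhamel (HUM.continuous_mulOp_flow _ Φ₀) (Set.right_mem_Icc.mpr hT.le),
      HUM.duhamel_humOperator, hu0, hΦ₀, smul_smul, mul_neg, Complex.I_mul_I, neg_neg, one_smul,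
      sub_self]
    exact map_zero (HUM.flowLI T)
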